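/- Let $G$ be an abelian group and let $V$ be a finite-dimensional Yetter--Drinfel'd module over the group algebra $\mathbb{C}[G]$ of diagonal type: there are a basis $v_1,\dots,v_n$ of $V$, elements $g_1,\dots,g_n\in G$ and characters $\chi_1,\dots,\chi_n$ of $G$ with $v_i\in V_{g_i}$ (i.e. the coaction is $\delta(v_i)=g_i\otimes v_i$) and $g.v_i=\chi_i(g)v_i$ for all $g\in G$. Put $q_{ij}=\chi_j(g_i)$, so that the braiding is $\sigma(v_i\otimes v_j)=q_{ij}\,v_j\otimes v_i$. Let $T(V)$ be the braided tensor Hopf algebra: its coproduct is the algebra map $\Delta:T(V)\to T(V)\,\underline{\otimes}\,T(V)$ with $\Delta(v)=v\otimes 1+1\otimes v$ for $v\in V$, where $T(V)\,\underline{\otimes}\,T(V)$ has the multiplication $(m\otimes m)(\mathrm{id}\otimes\sigma\otimes\mathrm{id})$; an element $x$ is primitive if $\Delta(x)=x\otimes 1+1\otimes x$. The braid group $\mathfrak{B}_m$ acts on $V^{\otimes m}$, its generator $\sigma_k$ acting by $\sigma$ on the factors $k,k+1$. For $1\le i\le j\le m$ define sets of signed permutations of $\{1,\dots,m\}$ by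 $\mathcal{P}_{i,i}=\{1\}$ and, for $i<j$, $\mathcal{P}_{i,j}=\mathcal{P}_{i+1,j}\cup(\mathcal{P}_{i,j-1}\circ -(i,j,j-1,\dots,i+1))$. The Dynkin operator is $P_m=\sum_{(\varepsilon,\omega)\in\mathcal{P}_{1,m}}\varepsilon\,T_\omega\in\mathbb{C}[\mathfrak{B}_m]$, where $T_\omega=\sigma_{i_1}\cdots\sigma_{i_r}$ for a reduced expression $\omega=s_{i_1}\cdots s_{i_r}$ in the adjacent transpositions. (1) Let $i\ne j$ and let $c_{ij}\le 0$ be an integer with $q_{ij}q_{ji}=q_{ii}^{c_{ij}}$ such that $-c_{ij}$ is the smallest non-negative integer with this property. Put $N=1-c_{ij}$. Then $P_{N+1}(v_i^Nv_j)$ is a primitive element of $T(V)$. (2) In particular the quantized Serre relations are primitive: suppose that $(c_{ij})$ is an integer matrix with $c_{ii}=2$ and $c_{ij}\le 0$ for $i\neq j$, that $d_1,\dots,d_n$ are positive integers with $d_ic_{ij}=d_jc_{ji}$, that $q\in\mathbb{C}^*$ is not a root of unity, and that $q_{ij}=q^{d_ic_{ij}}$ for all $i,j$. Then for $i\ne j$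 and $N=1-c_{ij}$, $$P_{N+1}(v_i^Nv_j)=\sum_{k=0}^{N}(-1)^k\begin{bmatrix}N\\k\end{bmatrix}_{q^{d_i}}v_i^{N-k}v_jv_i^k ,$$ and this element of $T(V)$ is primitive. Here $\begin{bmatrix}N\\k\end{bmatrix}_p=\frac{[N]_p!}{[k]_p!\,[N-k]_p!}$, $[m]_p!=\prod_{r=1}^m[r]_p$ and $[r]_p=\frac{p^r-p^{-r}}{p-p^{-1}}$. -/

import Mathlib

open scoped TensorProduct

noncomputable section

/-- A Yetter-Drinfel'd module over the group algebra `ℂ[G]` of an abelian group `G`.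
The module structure is a representation of `G`.  The comodule structure
`δ : V → ℂ[G] ⊗ V`, `δ v = ∑ g ⊗ v_g`, is recorded by the finitely supported function
`g ↦ v_g`; `v_g` is the component of `v` in `V_g` for the associated `G`-grading of `V`. -/
structure YetterDrinfeld (G V : Type*) [CommGroup G] [AddCommGroup V] [Module ℂ V] where
  /-- the action of `G` -/
  action : Representation ℂ G V
  /-- the coaction `v ↦ (g ↦ v_g)` -/
  coaction : V →ₗ[ℂ] (G →₀ V)
  /-- counit axiom `∑ v_g = v` -/
  counit : ∀ v, ((coaction v).sum fun _ w => w) = v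
  /-- coassociativity `δ (v_g) = g ⊗ v_g` -/
  coassoc : ∀ v g, coaction (coaction v g) = Finsupp.single g (coaction v g)
  /-- Yetter-Drinfel'd compatibility `δ (h.v) = ∑ g ⊗ h.v_g` (for `G` abelian) -/
  compat : ∀ h v g, coaction (action h v) g = action h (coaction v g)

namespace YetterDrinfeld

variable {G V : Type*} [CommGroup G] [AddCommGroup V] [Module ℂ V]

/-- `v ∈ V_g`, that is `δ v = g ⊗ v`. -/
def IsHomogeneous (Y : YetterDrinfeld G V) (g : G) (v : V) : Prop :=
  Y.coaction v = Finsupp.single g v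

/-- `V` is of diagonal type with respect to the basis `v`, the elements `g i` of `G` and the
characters `χ i` of `G`: `v i ∈ V_{g i}` and `h.(v i) = χ i h • v i`. -/
def IsDiagonal (Y : YetterDrinfeld G V) {n : ℕ} (v : Module.Basis (Fin n) ℂ V)
    (g : Fin n → G) (χ : Fin n → G →* ℂˣ) : Prop :=
  ∀ i, Y.IsHomogeneous (g i) (v i) ∧ ∀ h, Y.action h (v i) = (χ i h : ℂ) • v i

/-! ### The braided tensor Hopf algebra -/

/-- The action of `G` on `T(V)` by algebra automorphisms. -/
def tensorAction (Y : YetterDrinfeld G V) (g : G) :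
    TensorAlgebra ℂ V →ₐ[ℂ] TensorAlgebra ℂ V :=
  TensorAlgebra.lift ℂ (TensorAlgebra.ι ℂ ∘ₗ Y.action g)

/-- The coaction `T(V) → ℂ[G] ⊗ T(V)`: the algebra map extending the coaction of `V`.  The target is
the group algebra of `G` with coefficients in `T(V)`. -/
def tensorCoaction (Y : YetterDrinfeld G V) :
    TensorAlgebra ℂ V →ₐ[ℂ] MonoidAlgebra (TensorAlgebra ℂ V) G :=
  TensorAlgebra.lift ℂ
    ((MonoidAlgebra.coeffLinearEquiv ℂ).symm.toLinearMap ∘ₗ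
      Finsupp.mapRange.linearMap (TensorAlgebra.ι ℂ) ∘ₗ Y.coaction)

/-- The braiding of `T(V)`: `σ (x ⊗ y) = ∑ (g.y) ⊗ x_g`. -/
def tensorBraiding (Y : YetterDrinfeld G V) :
    TensorAlgebra ℂ V ⊗[ℂ] TensorAlgebra ℂ V →ₗ[ℂ] TensorAlgebra ℂ V ⊗[ℂ] TensorAlgebra ℂ V :=
  TensorProduct.lift
    (Finsupp.lsum ℂ (fun g => ((TensorProduct.mk ℂ _ _).flip.compl₂ (Y.tensorAction g).toLinearMap)) ∘ₗ
      (MonoidAlgebra.coeffLinearEquiv ℂ).toLinearMap ∘ₗ Y.tensorCoaction.toLinearMap)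

/-- The multiplication of the braided tensor square:
`(m ⊗ m) ∘ (id ⊗ σ ⊗ id)` on `T(V) ⊗ T(V) ⊗ T(V) ⊗ T(V)`. -/
def braidedMul (Y : YetterDrinfeld G V) :
    (TensorAlgebra ℂ V ⊗[ℂ] TensorAlgebra ℂ V) ⊗[ℂ] (TensorAlgebra ℂ V ⊗[ℂ] TensorAlgebra ℂ V) →ₗ[ℂ]
      TensorAlgebra ℂ V ⊗[ℂ] TensorAlgebra ℂ V :=
  let T := TensorAlgebra ℂ V
  TensorProduct.map (LinearMap.mul' ℂ T) (LinearMap.mul' ℂ T) ∘ₗ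
    (TensorProduct.assoc ℂ T T (T ⊗[ℂ] T)).symm.toLinearMap ∘ₗ
    LinearMap.lTensor T
      ((TensorProduct.assoc ℂ T T T).toLinearMap ∘ₗ
        LinearMap.rTensor T Y.tensorBraiding ∘ₗ
        (TensorProduct.assoc ℂ T T T).symm.toLinearMap) ∘ₗ
    (TensorProduct.assoc ℂ T T (T ⊗[ℂ] T)).toLinearMap

/-- Homogeneous elements of `T(V)`. -/
def IsTensorHomogeneous (Y : YetterDrinfeld G V) (g : G) (x : TensorAlgebra ℂ V) : Prop :=
  Y.tensorCoaction x = MonoidAlgebra.single g x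

theorem tensorCoaction_ι (Y : YetterDrinfeld G V) (v : V) :
    Y.tensorCoaction (TensorAlgebra.ι ℂ v) =
      MonoidAlgebra.ofCoeff ((Y.coaction v).mapRange (TensorAlgebra.ι ℂ) (map_zero _)) := by
  simp [tensorCoaction, Finsupp.mapRange.linearMap]
  rfl

theorem isTensorHomogeneous_ι (Y : YetterDrinfeld G V) {g : G} {v : V} (h : Y.IsHomogeneous g v) :
    Y.IsTensorHomogeneous g (TensorAlgebra.ι ℂ v) := by
  rw [IsTensorHomogeneous, tensorCoaction_ι, h, Finsupp.mapRange_single]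
  rfl

theorem isTensorHomogeneous_one (Y : YetterDrinfeld G V) : Y.IsTensorHomogeneous 1 1 := by
  rw [IsTensorHomogeneous, map_one]; rfl

theorem IsTensorHomogeneous.mul {Y : YetterDrinfeld G V} {g h : G} {x y : TensorAlgebra ℂ V}
    (hx : Y.IsTensorHomogeneous g x) (hy : Y.IsTensorHomogeneous h y) :
    Y.IsTensorHomogeneous (g * h) (x * y) := by
  rw [IsTensorHomogeneous] at *
  rw [map_mul, hx, hy, MonoidAlgebra.single_mul_single]

theorem isHomogeneous_action (Y : YetterDrinfeld G V) {g : G} (h : G) {v : V}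
    (hv : Y.IsHomogeneous g v) : Y.IsHomogeneous g (Y.action h v) := by
  classical
  ext k
  rw [Y.compat, hv, Finsupp.single_apply, Finsupp.single_apply]
  split_ifs <;> simp

theorem span_homogeneous (Y : YetterDrinfeld G V) :
    Submodule.span ℂ {v | ∃ g, Y.IsHomogeneous g v} = ⊤ := by
  rw [eq_top_iff]
  rintro v -
  rw [← Y.counit v]
  exact Submodule.sum_mem _ fun g _ => Submodule.subset_span ⟨g, Y.coassoc v g⟩

theorem span_tensorHomogeneous (Y : YetterDrinfeld G V) :
    Submodule.span ℂ {x | ∃ g, Y.IsTensorHomogeneous g x} = ⊤ := by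
  rw [eq_top_iff]
  rintro x -
  induction x using TensorAlgebra.induction with
  | algebraMap r =>
    rw [Algebra.algebraMap_eq_smul_one]
    exact Submodule.smul_mem _ _ (Submodule.subset_span ⟨1, Y.isTensorHomogeneous_one⟩)
  | ι v =>
    have hv : v ∈ Submodule.span ℂ {v | ∃ g, Y.IsHomogeneous g v} := by
      rw [Y.span_homogeneous]; trivial
    have := Submodule.mem_map_of_mem (f := TensorAlgebra.ι ℂ) hv
    rw [Submodule.map_span] at this
    refine Submodule.span_mono ?_ this
    rintro _ ⟨w, ⟨g, hg⟩, rfl⟩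
    exact ⟨g, Y.isTensorHomogeneous_ι hg⟩
  | mul a b ha hb =>
    have := Submodule.mul_mem_mul ha hb
    rw [Submodule.span_mul_span] at this
    refine Submodule.span_mono ?_ this
    rintro _ ⟨w, ⟨g, hg⟩, z, ⟨h, hh⟩, rfl⟩
    exact ⟨g * h, hg.mul hh⟩
  | add a b ha hb => exact Submodule.add_mem _ ha hb

theorem tensorAction_one (Y : YetterDrinfeld G V) : Y.tensorAction 1 = AlgHom.id ℂ _ := by
  ext v; simp [tensorAction]

theorem tensorAction_mul (Y : YetterDrinfeld G V) (g h : G) (x : TensorAlgebra ℂ V) :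
    Y.tensorAction (g * h) x = Y.tensorAction g (Y.tensorAction h x) := by
  have : Y.tensorAction (g * h) = (Y.tensorAction g).comp (Y.tensorAction h) := by
    ext v; simp [tensorAction]
  rw [this]; rfl

theorem tensorBraiding_tmul (Y : YetterDrinfeld G V) {g : G} {x : TensorAlgebra ℂ V}
    (hx : Y.IsTensorHomogeneous g x) (y : TensorAlgebra ℂ V) :
    Y.tensorBraiding (x ⊗ₜ y) = Y.tensorAction g y ⊗ₜ x := by
  rw [IsTensorHomogeneous] at hx
  simp [tensorBraiding, hx]

theorem braidedMul_tmul (Y : YetterDrinfeld G V) {g : G} {b : TensorAlgebra ℂ V}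
    (hb : Y.IsTensorHomogeneous g b) (a c d : TensorAlgebra ℂ V) :
    Y.braidedMul ((a ⊗ₜ b) ⊗ₜ (c ⊗ₜ d)) = (a * Y.tensorAction g c) ⊗ₜ (b * d) := by
  simp [braidedMul, Y.tensorBraiding_tmul hb]

/-- Linear maps out of `T(V) ⊗ T(V)` agree if they agree on `a ⊗ b`, `b` homogeneous. -/
theorem tensor_ext (Y : YetterDrinfeld G V) {M : Type*} [AddCommGroup M] [Module ℂ M]
    {f f' : TensorAlgebra ℂ V ⊗[ℂ] TensorAlgebra ℂ V →ₗ[ℂ] M}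
    (h : ∀ a b g, Y.IsTensorHomogeneous g b → f (a ⊗ₜ b) = f' (a ⊗ₜ b)) : f = f' := by
  apply TensorProduct.ext
  ext1 a
  apply LinearMap.ext_on Y.span_tensorHomogeneous
  rintro b ⟨g, hb⟩
  exact h a b g hb

theorem braidedMul_assoc (Y : YetterDrinfeld G V)
    (x y z : TensorAlgebra ℂ V ⊗[ℂ] TensorAlgebra ℂ V) :
    Y.braidedMul (Y.braidedMul (x ⊗ₜ y) ⊗ₜ z) = Y.braidedMul (x ⊗ₜ Y.braidedMul (y ⊗ₜ z)) := by
  have hz : ∀ a b g, Y.IsTensorHomogeneous g b → ∀ c d h, Y.IsTensorHomogeneous h d →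
      Y.braidedMul (Y.braidedMul ((a ⊗ₜ b) ⊗ₜ (c ⊗ₜ d)) ⊗ₜ z) =
        Y.braidedMul ((a ⊗ₜ b) ⊗ₜ Y.braidedMul ((c ⊗ₜ d) ⊗ₜ z)) := by
    intro a b g hb c d h hd
    induction z using TensorProduct.induction_on with
    | zero => simp
    | tmul e f =>
      rw [Y.braidedMul_tmul hb, Y.braidedMul_tmul (hb.mul hd), Y.braidedMul_tmul hd,
        Y.braidedMul_tmul hb, map_mul, tensorAction_mul, mul_assoc, mul_assoc]
    | add e f he hf => simp only [TensorProduct.tmul_add, map_add, he, hf]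
  let L := TensorAlgebra ℂ V ⊗[ℂ] TensorAlgebra ℂ V
  let μ : L →ₗ[ℂ] L →ₗ[ℂ] L := TensorProduct.curry Y.braidedMul
  have h1 : ∀ a b g, Y.IsTensorHomogeneous g b →
      Y.braidedMul (Y.braidedMul ((a ⊗ₜ b) ⊗ₜ y) ⊗ₜ z) =
        Y.braidedMul ((a ⊗ₜ b) ⊗ₜ Y.braidedMul (y ⊗ₜ z)) := by
    intro a b g hb
    have : μ.flip z ∘ₗ μ (a ⊗ₜ b) = μ (a ⊗ₜ b) ∘ₗ μ.flip z :=
      Y.tensor_ext fun c d h hd => hz a b g hb c d h hd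
    exact LinearMap.congr_fun this y
  have : μ.flip z ∘ₗ μ.flip y = μ.flip (μ y z) := Y.tensor_ext fun a b g hb => h1 a b g hb
  exact LinearMap.congr_fun this x

theorem braidedMul_one_left (Y : YetterDrinfeld G V)
    (x : TensorAlgebra ℂ V ⊗[ℂ] TensorAlgebra ℂ V) :
    Y.braidedMul ((1 ⊗ₜ 1) ⊗ₜ x) = x := by
  induction x using TensorProduct.induction_on with
  | zero => simp
  | tmul a b =>
    rw [Y.braidedMul_tmul Y.isTensorHomogeneous_one, tensorAction_one]
    simp
  | add a b ha hb => rw [TensorProduct.tmul_add, map_add, ha, hb]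

theorem braidedMul_one_right (Y : YetterDrinfeld G V)
    (x : TensorAlgebra ℂ V ⊗[ℂ] TensorAlgebra ℂ V) :
    Y.braidedMul (x ⊗ₜ (1 ⊗ₜ 1)) = x := by
  have : (TensorProduct.curry Y.braidedMul).flip (1 ⊗ₜ 1) = LinearMap.id :=
    Y.tensor_ext fun a b g hb => by
      simp [Y.braidedMul_tmul hb]
  exact LinearMap.congr_fun this x

/-- The vector space `T(V) ⊗ T(V)`, to be given the algebra structure of the braided tensor
product. -/
def BraidedSquare (_ : YetterDrinfeld G V) : Type _ :=
  TensorAlgebra ℂ V ⊗[ℂ] TensorAlgebra ℂ V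

instance (Y : YetterDrinfeld G V) : AddCommGroup Y.BraidedSquare :=
  inferInstanceAs (AddCommGroup (TensorAlgebra ℂ V ⊗[ℂ] TensorAlgebra ℂ V))

instance (Y : YetterDrinfeld G V) : Module ℂ Y.BraidedSquare :=
  inferInstanceAs (Module ℂ (TensorAlgebra ℂ V ⊗[ℂ] TensorAlgebra ℂ V))

/-- The identification of `T(V) ⊗ T(V)` with the braided tensor square, as vector spaces. -/
def toBraidedSquare (Y : YetterDrinfeld G V) :
    TensorAlgebra ℂ V ⊗[ℂ] TensorAlgebra ℂ V ≃ₗ[ℂ] Y.BraidedSquare :=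
  LinearEquiv.refl ℂ _

/-- The multiplication of the braided tensor square as a bilinear map. -/
def squareMul (Y : YetterDrinfeld G V) :
    Y.BraidedSquare →ₗ[ℂ] Y.BraidedSquare →ₗ[ℂ] Y.BraidedSquare :=
  TensorProduct.curry Y.braidedMul

/-- The pure tensor `a ⊗ b` in the braided tensor square. -/
def tmul (Y : YetterDrinfeld G V) (a b : TensorAlgebra ℂ V) : Y.BraidedSquare :=
  Y.toBraidedSquare (a ⊗ₜ[ℂ] b)

instance (Y : YetterDrinfeld G V) : Ring Y.BraidedSquare where
  mul x y := Y.squareMul x y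
  one := Y.tmul 1 1
  mul_assoc := Y.braidedMul_assoc
  one_mul := Y.braidedMul_one_left
  mul_one := Y.braidedMul_one_right
  left_distrib x y z := (Y.squareMul x).map_add y z
  right_distrib x y z := Y.squareMul.map_add₂ x y z
  zero_mul x := Y.squareMul.map_zero₂ x
  mul_zero x := (Y.squareMul x).map_zero
  zsmul := zsmulRec
  neg_add_cancel := neg_add_cancel

instance (Y : YetterDrinfeld G V) : Algebra ℂ Y.BraidedSquare :=
  Algebra.ofModule (fun r x y => Y.squareMul.map_smul₂ r x y)
    (fun r x y => (Y.squareMul x).map_smul r y)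

/-- The coproduct of the braided tensor Hopf algebra: the algebra map from `T(V)` to its braided
tensor square with `v ↦ v ⊗ 1 + 1 ⊗ v` for `v` in `V`. -/
def comul (Y : YetterDrinfeld G V) : TensorAlgebra ℂ V →ₐ[ℂ] Y.BraidedSquare :=
  TensorAlgebra.lift ℂ
    (Y.toBraidedSquare.toLinearMap ∘ₗ
      ((TensorProduct.mk ℂ (TensorAlgebra ℂ V) (TensorAlgebra ℂ V)).flip 1 +
        TensorProduct.mk ℂ (TensorAlgebra ℂ V) (TensorAlgebra ℂ V) 1) ∘ₗ TensorAlgebra.ι ℂ)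

/-- Primitive elements of the braided tensor Hopf algebra. -/
def IsPrimitive (Y : YetterDrinfeld G V) (x : TensorAlgebra ℂ V) : Prop :=
  Y.comul x = Y.tmul x 1 + Y.tmul 1 x

end YetterDrinfeld

/-! ### Braid groups, reduced words and Dynkin operators -/

/-- The defining relations of the braid group on `n` strands; the generators `σ_1, …, σ_{n-1}` are
numbered from `0`. -/
def braidRelations (n : ℕ) : Set (FreeGroup (Fin (n - 1))) :=
  {r | ∃ a b : Fin (n - 1), (a : ℕ) + 2 ≤ b ∧
      r = FreeGroup.of a * FreeGroup.of b * (FreeGroup.of b * FreeGroup.of a)⁻¹} ∪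
  {r | ∃ a b : Fin (n - 1), (a : ℕ) + 1 = b ∧
      r = FreeGroup.of a * FreeGroup.of b * FreeGroup.of a *
        (FreeGroup.of b * FreeGroup.of a * FreeGroup.of b)⁻¹}

/-- The braid group on `n` strands. -/
abbrev BraidGroup (n : ℕ) : Type := PresentedGroup (braidRelations n)

/-- The generators of the braid group. -/
def BraidGroup.σ {n : ℕ} (k : Fin (n - 1)) : BraidGroup n := PresentedGroup.of k

/-- The left position exchanged by the `k`-th adjacent transposition. -/
def leftPos {n : ℕ} (k : Fin (n - 1)) : Fin n := ⟨k, by omega⟩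

/-- The right position exchanged by the `k`-th adjacent transposition. -/
def rightPos {n : ℕ} (k : Fin (n - 1)) : Fin n := ⟨k + 1, by omega⟩

/-- The adjacent transpositions of the symmetric group. -/
def adjSwap {n : ℕ} (k : Fin (n - 1)) : Equiv.Perm (Fin n) := Equiv.swap (leftPos k) (rightPos k)

/-- `l` is a reduced expression of the permutation `w`. -/
def IsReducedWord {n : ℕ} (w : Equiv.Perm (Fin n)) (l : List (Fin (n - 1))) : Prop :=
  (l.map adjSwap).prod = w ∧
    ∀ l' : List (Fin (n - 1)), (l'.map adjSwap).prod = w → l.length ≤ l'.length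

theorem exists_word {n : ℕ} (w : Equiv.Perm (Fin n)) :
    ∃ l : List (Fin (n - 1)), (l.map adjSwap).prod = w := by
  rcases n with _ | n
  · exact ⟨[], Subsingleton.elim _ _⟩
  · have hw : w ∈ Submonoid.closure (Set.range fun i : Fin n ↦ Equiv.swap i.castSucc i.succ) := by
      rw [Equiv.Perm.mclosure_swap_castSucc_succ]; trivial
    induction hw using Submonoid.closure_induction with
    | mem x hx => obtain ⟨i, rfl⟩ := hx; exact ⟨[i], by simp [adjSwap]; rfl⟩
    | one => exact ⟨[], rfl⟩
    | mul x y _ _ hx hy =>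
      obtain ⟨l, rfl⟩ := hx
      obtain ⟨l', rfl⟩ := hy
      exact ⟨l ++ l', by simp⟩

theorem exists_isReducedWord {n : ℕ} (w : Equiv.Perm (Fin n)) : ∃ l, IsReducedWord w l := by
  classical
  have h : ∃ m, ∃ l : List (Fin (n - 1)), (l.map adjSwap).prod = w ∧ l.length = m :=
    (exists_word w).elim fun l hl => ⟨_, l, hl, rfl⟩
  obtain ⟨l, hl, hm⟩ := Nat.find_spec h
  exact ⟨l, hl, fun l' hl' => hm ▸ Nat.find_min' h ⟨l', hl', rfl⟩⟩

/-- The lift `T_w` of a permutation `w` to the braid group, through a reduced expression of `w`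
(by Matsumoto's theorem it does not depend on the choice of that expression). -/
def matsumotoLift {n : ℕ} (w : Equiv.Perm (Fin n)) : BraidGroup n :=
  ((exists_isReducedWord w).choose.map BraidGroup.σ).prod

/-- The Matsumoto section `T : ℂ[𝔖_n] → ℂ[𝔅_n]`. -/
def matsumoto (n : ℕ) :
    MonoidAlgebra ℂ (Equiv.Perm (Fin n)) →ₗ[ℂ] MonoidAlgebra ℂ (BraidGroup n) :=
  MonoidAlgebra.mapDomainLinearMap ℂ ℂ matsumotoLift

/-- The set `𝒫_{i,j}` of signed permutations, for `j = i + d`, by recursion on `d`: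
`𝒫_{i,i} = {1}` and `𝒫_{i,j} = 𝒫_{i+1,j} ∪ (𝒫_{i,j-1} ∘ -(i, j, j-1, …, i+1))`.
Positions are numbered from `0`, and `Fin.cycleIcc i j` is the cycle `(i, i+1, …, j)`. -/
def dynkinSet {n : ℕ} : (d i : ℕ) → i + d < n → Finset (ℤˣ × Equiv.Perm (Fin n))
  | 0, _, _ => {1}
  | d + 1, i, h =>
    dynkinSet d (i + 1) (by omega) ∪
      (dynkinSet d i (by omega)).image
        (· * (-1, (Fin.cycleIcc ⟨i, by omega⟩ ⟨i + (d + 1), h⟩)⁻¹))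

/-- The Dynkin element `P_{1,n} = ∑ ε ω` of `ℂ[𝔖_n]`, here for `n = N + 1`. -/
def dynkinSum (N : ℕ) : MonoidAlgebra ℂ (Equiv.Perm (Fin (N + 1))) :=
  ∑ p ∈ dynkinSet N 0 (by omega), MonoidAlgebra.single p.2 ((p.1 : ℤ) : ℂ)

/-- The Dynkin operator `P_n = T_{P_{1,n}}` in `ℂ[𝔅_n]`, here for `n = N + 1`. -/
def dynkinOperator (N : ℕ) : MonoidAlgebra ℂ (BraidGroup (N + 1)) :=
  matsumoto (N + 1) (dynkinSum N)

/-! ### The action of the braid group on tensor powers -/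

namespace YetterDrinfeld

variable {G V : Type*} [CommGroup G] [AddCommGroup V] [Module ℂ V]

/-- The projection `v ↦ v_g`. -/
def component (Y : YetterDrinfeld G V) (g : G) : V →ₗ[ℂ] V := Finsupp.lapply g ∘ₗ Y.coaction

/-- The braiding `σ (v ⊗ w) = ∑ (g.w) ⊗ v_g` applied to the positions `k`, `k + 1`
of `V^{⊗ n}`.  As `V` is finite dimensional, only finitely many components are nonzero. -/
def braidAt (Y : YetterDrinfeld G V) [Module.Finite ℂ V] {n : ℕ} (k : Fin (n - 1)) :
    Module.End ℂ (TensorPower ℂ n V) :=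
  ∑ᶠ g : G, (PiTensorProduct.reindex ℂ (fun _ => V) (adjSwap k)).toLinearMap ∘ₗ
    PiTensorProduct.map (Function.update (Function.update (fun _ => LinearMap.id)
      (leftPos k) (Y.component g)) (rightPos k) (Y.action g))

/-- The inverse braiding `v ⊗ w ↦ ∑ w_g ⊗ (g⁻¹.v)` at the positions `k`, `k + 1`. -/
def braidAtInv (Y : YetterDrinfeld G V) [Module.Finite ℂ V] {n : ℕ} (k : Fin (n - 1)) :
    Module.End ℂ (TensorPower ℂ n V) :=
  ∑ᶠ g : G, (PiTensorProduct.reindex ℂ (fun _ => V) (adjSwap k)).toLinearMap ∘ₗ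
    PiTensorProduct.map (Function.update (Function.update (fun _ => LinearMap.id)
      (leftPos k) (Y.action g⁻¹)) (rightPos k) (Y.component g))

theorem finite_component (Y : YetterDrinfeld G V) [Module.Finite ℂ V] :
    {g | Y.component g ≠ 0}.Finite := by
  classical
  let b := Module.finBasis ℂ V
  refine (Finset.univ.biUnion fun i => (Y.coaction (b i)).support).finite_toSet.subset ?_
  intro g hg
  by_contra h
  apply hg
  apply b.ext
  intro i
  simp only [Finset.coe_biUnion, Set.mem_iUnion, not_exists] at h
  have := h i (by simp)
  simpa [component] using this

theorem component_of_homogeneous (Y : YetterDrinfeld G V) {g : G} {v : V}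
    (hv : Y.IsHomogeneous g v) : Y.component g v = v := by
  rw [IsHomogeneous] at hv
  simp [component, hv]

theorem component_of_ne (Y : YetterDrinfeld G V) {g h : G} {v : V}
    (hv : Y.IsHomogeneous g v) (hh : h ≠ g) : Y.component h v = 0 := by
  classical
  rw [IsHomogeneous] at hv
  simp [component, hv, hh.symm]

theorem leftPos_ne_rightPos {n : ℕ} (k : Fin (n - 1)) : leftPos k ≠ rightPos k := by
  simp [leftPos, rightPos]

/-- The value of the braiding on a tensor whose `k`-th factor is homogeneous. -/
theorem braidAt_tprod (Y : YetterDrinfeld G V) [Module.Finite ℂ V] {n : ℕ} (k : Fin (n - 1))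
    (f : Fin n → V) {g : G} (hf : Y.IsHomogeneous g (f (leftPos k))) :
    Y.braidAt k (PiTensorProduct.tprod ℂ f) = PiTensorProduct.tprod ℂ
      (fun l => if l = leftPos k then Y.action g (f (rightPos k))
        else if l = rightPos k then f (leftPos k) else f l) := by
  classical
  rw [braidAt, finsum_eq_sum_of_support_subset (s := insert g Y.finite_component.toFinset)]
  · rw [LinearMap.sum_apply, Finset.sum_eq_single g]
    · simp only [LinearMap.comp_apply, PiTensorProduct.map_tprod, LinearEquiv.coe_coe,
        PiTensorProduct.reindex_tprod]
      congr 1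
      ext l
      have hne := leftPos_ne_rightPos k
      by_cases h1 : l = leftPos k
      · subst h1; simp [adjSwap]
      · by_cases h2 : l = rightPos k
        · subst h2; simp [adjSwap, hne.symm, hne, Y.component_of_homogeneous hf]
        · simp [adjSwap, h1, h2, Equiv.swap_apply_of_ne_of_ne]
    · intro h _ hh
      simp only [LinearMap.comp_apply, PiTensorProduct.map_tprod, LinearEquiv.coe_coe]
      rw [(PiTensorProduct.tprod ℂ).map_coord_zero (leftPos k), map_zero]
      simp [Function.update_of_ne (leftPos_ne_rightPos k), Y.component_of_ne hf hh]
    · simp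
  · intro h hh
    rw [Finset.coe_insert, Set.Finite.coe_toFinset]
    right
    intro h0
    apply hh
    ext f
    simp only [LinearMap.comp_apply, PiTensorProduct.map_tprod, LinearEquiv.coe_coe,
      LinearMap.compMultilinearMap_apply, LinearMap.zero_apply]
    rw [(PiTensorProduct.tprod ℂ).map_coord_zero (leftPos k), map_zero]
    simp [Function.update_of_ne (leftPos_ne_rightPos k), h0]

theorem braidAtInv_tprod (Y : YetterDrinfeld G V) [Module.Finite ℂ V] {n : ℕ} (k : Fin (n - 1))
    (f : Fin n → V) {g : G} (hf : Y.IsHomogeneous g (f (rightPos k))) :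
    Y.braidAtInv k (PiTensorProduct.tprod ℂ f) = PiTensorProduct.tprod ℂ
      (fun l => if l = leftPos k then f (rightPos k)
        else if l = rightPos k then Y.action g⁻¹ (f (leftPos k)) else f l) := by
  classical
  rw [braidAtInv, finsum_eq_sum_of_support_subset (s := insert g Y.finite_component.toFinset)]
  · rw [LinearMap.sum_apply, Finset.sum_eq_single g]
    · simp only [LinearMap.comp_apply, PiTensorProduct.map_tprod, LinearEquiv.coe_coe,
        PiTensorProduct.reindex_tprod]
      congr 1
      ext l
      have hne := leftPos_ne_rightPos k
      by_cases h1 : l = leftPos k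
      · subst h1; simp [adjSwap, Y.component_of_homogeneous hf]
      · by_cases h2 : l = rightPos k
        · subst h2; simp [adjSwap, hne.symm, hne]
        · simp [adjSwap, h1, h2, Equiv.swap_apply_of_ne_of_ne]
    · intro h _ hh
      simp only [LinearMap.comp_apply, PiTensorProduct.map_tprod, LinearEquiv.coe_coe]
      rw [(PiTensorProduct.tprod ℂ).map_coord_zero (rightPos k), map_zero]
      simp [Y.component_of_ne hf hh]
    · simp
  · intro h hh
    rw [Finset.coe_insert, Set.Finite.coe_toFinset]
    right
    intro h0
    apply hh
    ext f
    simp only [LinearMap.comp_apply, PiTensorProduct.map_tprod, LinearEquiv.coe_coe,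
      LinearMap.compMultilinearMap_apply, LinearMap.zero_apply]
    rw [(PiTensorProduct.tprod ℂ).map_coord_zero (rightPos k), map_zero]
    simp [h0]

/-- Endomorphisms of `V^{⊗ n}` agree if they agree on tensors of homogeneous vectors. -/
theorem tensorPower_ext (Y : YetterDrinfeld G V) {n : ℕ}
    {φ ψ : Module.End ℂ (TensorPower ℂ n V)}
    (h : ∀ (f : Fin n → V) (γ : Fin n → G), (∀ l, Y.IsHomogeneous (γ l) (f l)) →
      φ (PiTensorProduct.tprod ℂ f) = ψ (PiTensorProduct.tprod ℂ f)) : φ = ψ := by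
  let b := Module.Basis.ofSpan Y.span_homogeneous.ge
  have hb : ∀ i, ∃ g, Y.IsHomogeneous g (b i) := fun i =>
    Module.Basis.ofSpan_subset Y.span_homogeneous.ge ⟨i, rfl⟩
  choose γ hγ using hb
  apply PiTensorProduct.ext
  refine Module.Basis.ext_multilinear (fun _ => b) fun v => ?_
  exact h _ (fun l => γ (v l)) fun l => hγ (v l)

theorem isHomogeneous_ite (Y : YetterDrinfeld G V) {n : ℕ} (k : Fin (n - 1)) {f : Fin n → V}
    {γ : Fin n → G} (hf : ∀ l, Y.IsHomogeneous (γ l) (f l)) (h : G) (l : Fin n) :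
    Y.IsHomogeneous
      (if l = leftPos k then γ (rightPos k) else if l = rightPos k then γ (leftPos k) else γ l)
      (if l = leftPos k then Y.action h (f (rightPos k))
        else if l = rightPos k then f (leftPos k) else f l) := by
  split_ifs
  · exact Y.isHomogeneous_action _ (hf _)
  · exact hf _
  · exact hf _

/-- The braiding at the positions `k`, `k + 1`, as an invertible operator. -/
def braidUnit (Y : YetterDrinfeld G V) [Module.Finite ℂ V] {n : ℕ} (k : Fin (n - 1)) :
    (Module.End ℂ (TensorPower ℂ n V))ˣ where
  val := Y.braidAt k
  inv := Y.braidAtInv k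
  val_inv := Y.tensorPower_ext fun f γ hf => by
    have hne := leftPos_ne_rightPos k
    rw [Module.End.mul_apply, Y.braidAtInv_tprod k f (hf _),
      Y.braidAt_tprod k _ (g := γ (rightPos k)) (by simpa using hf _)]
    simp only [Module.End.one_apply]
    congr 1
    ext l
    by_cases h1 : l = leftPos k
    · subst h1; simp [hne.symm, ← Module.End.mul_apply, ← map_mul]
    · by_cases h2 : l = rightPos k
      · subst h2; simp [hne.symm]
      · simp [h1, h2]
  inv_val := Y.tensorPower_ext fun f γ hf => by
    have hne := leftPos_ne_rightPos k
    rw [Module.End.mul_apply, Y.braidAt_tprod k f (hf _),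
      Y.braidAtInv_tprod k _ (g := γ (leftPos k)) (by simpa [hne.symm] using hf _)]
    simp only [Module.End.one_apply]
    congr 1
    ext l
    by_cases h1 : l = leftPos k
    · subst h1; simp [hne.symm]
    · by_cases h2 : l = rightPos k
      · subst h2; simp [hne.symm, ← Module.End.mul_apply, ← map_mul]
      · simp [h1, h2]

theorem braidUnit_comm (Y : YetterDrinfeld G V) [Module.Finite ℂ V] {n : ℕ} (a b : Fin (n - 1))
    (hab : (a : ℕ) + 2 ≤ b) :
    (Y.braidUnit a : (Module.End ℂ (TensorPower ℂ n V))ˣ) * Y.braidUnit b =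
      Y.braidUnit b * Y.braidUnit a := by
  have e1 : leftPos a ≠ leftPos b := by simp [leftPos]; omega
  have e2 : leftPos a ≠ rightPos b := by simp [leftPos, rightPos]; omega
  have e3 : rightPos a ≠ leftPos b := by simp [leftPos, rightPos]; omega
  have e4 : rightPos a ≠ rightPos b := by simp [rightPos]; omega
  have ea := leftPos_ne_rightPos a
  have eb := leftPos_ne_rightPos b
  apply Units.ext
  refine Y.tensorPower_ext fun f γ hf => ?_
  change Y.braidAt a (Y.braidAt b _) = Y.braidAt b (Y.braidAt a _)
  rw [Y.braidAt_tprod a f (hf _), Y.braidAt_tprod b f (hf _),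
    Y.braidAt_tprod a _ (Y.isHomogeneous_ite b hf _ _),
    Y.braidAt_tprod b _ (Y.isHomogeneous_ite a hf _ _)]
  congr 1
  ext l
  by_cases h1 : l = leftPos a
  · subst h1; simp [*]
  by_cases h2 : l = rightPos a
  · subst h2; simp [*, ea.symm]
  by_cases h3 : l = leftPos b
  · subst h3; simp [e1.symm, e2.symm, e3.symm, e4.symm]
  by_cases h4 : l = rightPos b
  · subst h4; simp [e1.symm, e2.symm, e3.symm, e4.symm, eb.symm]
  simp [*]

theorem braidUnit_braid (Y : YetterDrinfeld G V) [Module.Finite ℂ V] {n : ℕ} (a b : Fin (n - 1))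
    (hab : (a : ℕ) + 1 = b) :
    (Y.braidUnit a : (Module.End ℂ (TensorPower ℂ n V))ˣ) * Y.braidUnit b * Y.braidUnit a =
      Y.braidUnit b * Y.braidUnit a * Y.braidUnit b := by
  have e1 : leftPos a ≠ leftPos b := by simp [leftPos]; omega
  have e2 : leftPos a ≠ rightPos b := by simp [leftPos, rightPos]; omega
  have e3 : rightPos a = leftPos b := by simp [leftPos, rightPos]; omega
  have eb := leftPos_ne_rightPos b
  apply Units.ext
  refine Y.tensorPower_ext fun f γ hf => ?_
  change Y.braidAt a (Y.braidAt b (Y.braidAt a _)) = Y.braidAt b (Y.braidAt a (Y.braidAt b _))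
  have ha := Y.isHomogeneous_ite a hf (γ (leftPos a))
  have hb := Y.isHomogeneous_ite b hf (γ (leftPos b))
  rw [Y.braidAt_tprod a f (hf _), Y.braidAt_tprod b f (hf _),
    Y.braidAt_tprod a _ (hb _), Y.braidAt_tprod b _ (ha _),
    Y.braidAt_tprod a _ (Y.isHomogeneous_ite b ha _ _),
    Y.braidAt_tprod b _ (Y.isHomogeneous_ite a hb _ _)]
  congr 1
  ext l
  rw [e3]
  by_cases h1 : l = leftPos a
  · subst h1
    simp [e1, e2, e1.symm, e2.symm, eb.symm, ← Module.End.mul_apply, ← map_mul, mul_comm]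
  by_cases h3 : l = leftPos b
  · subst h3; simp [e1, e2, e1.symm, e2.symm, eb.symm]
  by_cases h4 : l = rightPos b
  · subst h4; simp [e1, e2, e1.symm, e2.symm, eb.symm]
  simp [*]

/-- The action of the braid group on `V^{⊗ n}`. -/
def braidAction (Y : YetterDrinfeld G V) [Module.Finite ℂ V] (n : ℕ) :
    Representation ℂ (BraidGroup n) (TensorPower ℂ n V) :=
  (Units.coeHom _).comp
    (PresentedGroup.toGroup (rels := braidRelations n) (f := fun k => Y.braidUnit k) (by
      rintro r (⟨a, b, hab, rfl⟩ | ⟨a, b, hab, rfl⟩)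
      · simp only [map_mul, map_inv, FreeGroup.lift_apply_of]
        rw [Y.braidUnit_comm a b hab, mul_inv_cancel]
      · simp only [map_mul, map_inv, FreeGroup.lift_apply_of]
        rw [Y.braidUnit_braid a b hab, mul_inv_cancel]))

/-- The element `P_{N+1}(v^N w)` of `T(V)`: the Dynkin operator applied to the tensor
`v ⊗ ⋯ ⊗ v ⊗ w` with `N` factors `v`. -/
def dynkinElement (Y : YetterDrinfeld G V) [Module.Finite ℂ V] (N : ℕ) (v w : V) :
    TensorAlgebra ℂ V :=
  TensorPower.toTensorAlgebra
    ((Y.braidAction (N + 1)).asAlgebraHom (dynkinOperator N)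
      (PiTensorProduct.tprod ℂ (Fin.snoc (fun _ : Fin N => v) w : Fin (N + 1) → V)))

end YetterDrinfeld

/-! ### Quantized Serre elements -/

/-- The quantum integer `[m]_q = (q^m - q^{-m}) / (q - q^{-1})`. -/
def quantumInt (q : ℂ) (m : ℕ) : ℂ := (q ^ m - q⁻¹ ^ m) / (q - q⁻¹)

/-- The quantum factorial `[m]_q!`. -/
def quantumFactorial (q : ℂ) (m : ℕ) : ℂ := ∏ k ∈ Finset.range m, quantumInt q (k + 1)

/-- The quantum binomial coefficient, for `k ≤ m` and `q` nonzero and not a root of unity. -/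
def quantumBinomial (q : ℂ) (m k : ℕ) : ℂ :=
  quantumFactorial q m / (quantumFactorial q k * quantumFactorial q (m - k))

/-- The left-hand side `∑ (-1)^k [N choose k]_q x^{N-k} y x^k` of the quantized Serre relation. -/
def serreElement {A : Type*} [Ring A] [Algebra ℂ A] (q : ℂ) (N : ℕ) (x y : A) : A :=
  ∑ k ∈ Finset.range (N + 1),
    ((-1) ^ k * quantumBinomial q N k) • (x ^ (N - k) * y * x ^ k)

end

/-! ### Inversions and reduced words -/

/-! Write `x = v_i`, `y = v_j`, `q = q_ii`, `s = q_ij`, `t = q_ji`. The proof identifies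
`P_{N+1}(v_i^N v_j)` with the iterated braided commutator `y_N`, where `y_0 = y` and `y_{d+1} = x
y_d - q^d s y_d x`, and then computes its coproduct in closed form.

For the identification, a reduced word has as many letters as its permutation has inversions, so
each letter, read from the right, creates exactly one inversion and contributes one factor `q_ab`.
Hence `T_ω` sends a tensor of basis vectors to the permuted tensor times a product over the
inversions of `ω` (`IsDiagonal.braidAction_matsumotoLift`). On `x ⋯ x y`, the cycle in the recursion
for `𝒫` moves one `x` to the right across `d` letters `x` and the letter `y`. This costs `q^d s`, so
the recursion becomes that of `y_d` (`IsDiagonal.sum_dynkinSet`).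

For the coproduct, `Δ(y_d) = y_d ⊗ 1 + ∑_{k+e=d} c(k,e) x^k ⊗ y_e`, with `c(k,e)` a Gaussian
binomial times `∏_{l<k} (1 - q^{e+l} st)` (`comul_iteratedBracket`). If `k ≥ 1` and `k + e = N`, the
last factor is `1 - q^{N-1} st`. It vanishes for `N = 1 - c_ij`, since `st = q^{c_ij}`, and only `1
⊗ y_N` survives of the sum.

For the Serre relations put `p = q^{d_i}` with the parameter `q` of part (2), so that `q_ii = p²`
and `q_ij = q_ji = p^c`. The quantum Pascal rule expands `y_d` with coefficients `(-1)^k [d choose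
k]_p p^{k(d-1+c)}`, and the extra power of `p` disappears at `d = 1 - c`. -/

theorem adjSwap_apply_val {n : ℕ} (k : Fin (n - 1)) (a : Fin n) :
    (adjSwap k a : ℕ) = if (a : ℕ) = k then (k : ℕ) + 1 else if (a : ℕ) = k + 1 then (k : ℕ) else a := by
  rw [adjSwap, Equiv.swap_apply_def]
  simp only [leftPos, rightPos, Fin.ext_iff]
  split_ifs <;> rfl

theorem adjSwap_mul_self {n : ℕ} (k : Fin (n - 1)) : adjSwap k * adjSwap k = 1 :=
  Equiv.swap_mul_self _ _

theorem adjSwap_adjSwap {n : ℕ} (k : Fin (n - 1)) (a : Fin n) : adjSwap k (adjSwap k a) = a :=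
  Equiv.swap_apply_self _ _ _

theorem adjSwap_leftPos {n : ℕ} (k : Fin (n - 1)) : adjSwap k (leftPos k) = rightPos k :=
  Equiv.swap_apply_left _ _

theorem adjSwap_rightPos {n : ℕ} (k : Fin (n - 1)) : adjSwap k (rightPos k) = leftPos k :=
  Equiv.swap_apply_right _ _

/-- An adjacent transposition preserves the order of all pairs but the one it exchanges. -/
theorem adjSwap_lt_adjSwap {n : ℕ} (k : Fin (n - 1)) {a b : Fin n} (hab : a < b)
    (h : ¬(a = leftPos k ∧ b = rightPos k)) : adjSwap k a < adjSwap k b := by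
  have ha := adjSwap_apply_val k a
  have hb := adjSwap_apply_val k b
  simp only [leftPos, rightPos, Fin.ext_iff] at h
  rw [Fin.lt_def] at *
  rw [ha, hb]
  split_ifs <;> omega

/-- The inversions of a permutation. -/
def inversionPairs {n : ℕ} (w : Equiv.Perm (Fin n)) : Finset (Fin n × Fin n) :=
  Finset.univ.filter fun p => p.1 < p.2 ∧ w p.2 < w p.1

theorem mem_inversionPairs {n : ℕ} {w : Equiv.Perm (Fin n)} {p : Fin n × Fin n} :
    p ∈ inversionPairs w ↔ p.1 < p.2 ∧ w p.2 < w p.1 := by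
  simp [inversionPairs]

theorem inversionPairs_one {n : ℕ} : inversionPairs (1 : Equiv.Perm (Fin n)) = ∅ := by
  ext p
  simpa [mem_inversionPairs] using fun h : p.1 < p.2 => h.le

theorem leftPos_lt_rightPos {n : ℕ} (k : Fin (n - 1)) : leftPos k < rightPos k :=
  Nat.lt_succ_self k

/-- Multiplying on the right by an adjacent transposition at an ascent relabels the old inversions
and adds the exchanged pair, because every other pair keeps its order. Lengths and braiding factors
both follow from this. -/
theorem inversionPairs_mul_adjSwap {n : ℕ} {w : Equiv.Perm (Fin n)} {k : Fin (n - 1)}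
    (h : w (leftPos k) < w (rightPos k)) :
    inversionPairs (w * adjSwap k) = insert (leftPos k, rightPos k)
      ((inversionPairs w).image (Prod.map (adjSwap k) (adjSwap k))) := by
  ext ⟨a, b⟩
  rw [mem_inversionPairs, Finset.mem_insert, Finset.mem_image]
  constructor
  · rintro ⟨hab, hw⟩
    by_cases hk : a = leftPos k ∧ b = rightPos k
    · left; rw [hk.1, hk.2]
    · right
      refine ⟨(adjSwap k a, adjSwap k b), mem_inversionPairs.2 ⟨adjSwap_lt_adjSwap k hab hk, hw⟩, ?_⟩
      simp [adjSwap_adjSwap]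
  · rintro (hk | ⟨⟨c, d⟩, hp, hk⟩)
    · obtain ⟨rfl, rfl⟩ := Prod.mk.inj hk
      refine ⟨leftPos_lt_rightPos k, ?_⟩
      simpa [adjSwap_leftPos, adjSwap_rightPos] using h
    · obtain ⟨hcd, hw⟩ := mem_inversionPairs.1 hp
      obtain ⟨rfl, rfl⟩ := Prod.mk.inj hk
      refine ⟨adjSwap_lt_adjSwap k hcd ?_, by simpa [adjSwap_adjSwap] using hw⟩
      rintro ⟨h1, h2⟩
      simp only at h1 h2 hw
      rw [h1, h2] at hw
      exact lt_asymm h hw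

/-- The values lie in an arbitrary commutative monoid so that the same identity counts inversions
and multiplies braiding factors. -/
theorem prod_inversionPairs_mul_adjSwap {M : Type*} [CommMonoid M] {n : ℕ}
    {w : Equiv.Perm (Fin n)} {k : Fin (n - 1)} (h : w (leftPos k) < w (rightPos k))
    (F : Fin n × Fin n → M) :
    ∏ p ∈ inversionPairs (w * adjSwap k), F p =
      F (leftPos k, rightPos k) * ∏ p ∈ inversionPairs w, F (adjSwap k p.1, adjSwap k p.2) := by
  rw [inversionPairs_mul_adjSwap h, Finset.prod_insert, Finset.prod_image]
  · rfl
  · exact ((adjSwap k).injective.prodMap (adjSwap k).injective).injOn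
  -- The added pair is new: its preimage would be the reversed pair, which is not increasing.
  · rw [Finset.mem_image]
    rintro ⟨⟨c, d⟩, hp, hk⟩
    obtain ⟨h1, h2⟩ := Prod.mk.inj hk
    have hcd := (mem_inversionPairs.1 hp).1
    simp only at h1 h2 hcd
    rw [← adjSwap_adjSwap k c, ← adjSwap_adjSwap k d, h1, h2, adjSwap_leftPos,
      adjSwap_rightPos] at hcd
    exact lt_asymm hcd (leftPos_lt_rightPos k)

theorem card_inversionPairs_mul_adjSwap {n : ℕ} {w : Equiv.Perm (Fin n)} {k : Fin (n - 1)}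
    (h : w (leftPos k) < w (rightPos k)) :
    (inversionPairs (w * adjSwap k)).card = (inversionPairs w).card + 1 := by
  -- The constant `1` of ℕ, written multiplicatively, turns the product into the cardinality.
  have := prod_inversionPairs_mul_adjSwap h (fun _ => Multiplicative.ofAdd (1 : ℕ))
  rw [Finset.prod_const, Finset.prod_const] at this
  have := congrArg Multiplicative.toAdd this
  simpa [add_comm] using this

theorem card_inversionPairs_of_descent {n : ℕ} {w : Equiv.Perm (Fin n)} {k : Fin (n - 1)}
    (h : w (rightPos k) < w (leftPos k)) :
    (inversionPairs w).card = (inversionPairs (w * adjSwap k)).card + 1 := by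
  have := card_inversionPairs_mul_adjSwap (w := w * adjSwap k) (k := k)
    (by simpa [adjSwap_leftPos, adjSwap_rightPos] using h)
  rwa [mul_assoc, adjSwap_mul_self, mul_one] at this

theorem leftPos_lt_or_rightPos_lt {n : ℕ} (w : Equiv.Perm (Fin n)) (k : Fin (n - 1)) :
    w (leftPos k) < w (rightPos k) ∨ w (rightPos k) < w (leftPos k) :=
  lt_or_gt_of_ne fun h => (leftPos_lt_rightPos k).ne (w.injective h)

theorem card_inversionPairs_le {n : ℕ} (l : List (Fin (n - 1))) :
    (inversionPairs (l.map adjSwap).prod).card ≤ l.length := by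
  induction l using List.reverseRecOn with
  | nil => simp [inversionPairs_one]
  | append_singleton l k ih =>
    rw [List.map_append, List.prod_append, List.map_singleton, List.prod_singleton,
      List.length_append, List.length_singleton]
    rcases leftPos_lt_or_rightPos_lt (l.map adjSwap).prod k with h | h
    · rw [card_inversionPairs_mul_adjSwap h]; omega
    · have := card_inversionPairs_of_descent h; omega

/-- A permutation without descents is an order automorphism of a finite chain, and the identity is
the only one. -/
theorem eq_one_of_forall_leftPos_lt {n : ℕ} {w : Equiv.Perm (Fin n)}
    (h : ∀ k, w (leftPos k) < w (rightPos k)) : w = 1 := by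
  rcases n with _ | n
  · exact Subsingleton.elim _ _
  · have hw : StrictMono w := Fin.strictMono_iff_lt_succ.2 fun i => h i
    have : (hw.orderIsoOfSurjective w w.surjective) = OrderIso.refl _ := Subsingleton.elim _ _
    ext a
    exact congrArg Fin.val (DFunLike.congr_fun this a)

/-- Bubble sort: removing a descent lowers the number of inversions by one, and no descent is left
only at the identity. -/
theorem exists_word_length_eq {n : ℕ} (w : Equiv.Perm (Fin n)) :
    ∃ l : List (Fin (n - 1)), (l.map adjSwap).prod = w ∧ l.length = (inversionPairs w).card := by
  induction hc : (inversionPairs w).card generalizing w with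
  | zero =>
    refine ⟨[], (eq_one_of_forall_leftPos_lt fun k => ?_).symm, rfl⟩
    refine (leftPos_lt_or_rightPos_lt w k).resolve_right fun h => ?_
    have := card_inversionPairs_of_descent h
    omega
  | succ m ih =>
    by_cases hw : ∀ k, w (leftPos k) < w (rightPos k)
    · rw [eq_one_of_forall_leftPos_lt hw, inversionPairs_one] at hc
      simp at hc
    · obtain ⟨k, hk⟩ := not_forall.1 hw
      have hk := (leftPos_lt_or_rightPos_lt w k).resolve_left hk
      have := card_inversionPairs_of_descent hk
      obtain ⟨l, hl, hm⟩ := ih (w * adjSwap k) (by omega)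
      exact ⟨l ++ [k], by simp [hl, mul_assoc, adjSwap_mul_self], by simp [hm]⟩

theorem IsReducedWord.length_eq {n : ℕ} {w : Equiv.Perm (Fin n)} {l : List (Fin (n - 1))}
    (h : IsReducedWord w l) : l.length = (inversionPairs w).card := by
  obtain ⟨l', hl', hm⟩ := exists_word_length_eq w
  refine le_antisymm (hm ▸ h.2 l' hl') ?_
  rw [← h.1]
  exact card_inversionPairs_le l

/-! ### Reduced words acting on tensors of basis vectors -/

/-- The product of `Q (f a) (f b)` over the inversions `(a, b)` of `w`. -/
def inversionWeight {ι R : Type*} [CommMonoid R] (Q : Matrix ι ι R) {n : ℕ} (f : Fin n → ι)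
    (w : Equiv.Perm (Fin n)) : R :=
  ∏ p ∈ inversionPairs w, Q (f p.1) (f p.2)

theorem inversionWeight_one {ι R : Type*} [CommMonoid R] (Q : Matrix ι ι R) {n : ℕ}
    (f : Fin n → ι) : inversionWeight Q f 1 = 1 := by
  rw [inversionWeight, inversionPairs_one, Finset.prod_empty]

theorem inversionWeight_mul_adjSwap {ι R : Type*} [CommMonoid R] (Q : Matrix ι ι R) {n : ℕ}
    (f : Fin n → ι) {w : Equiv.Perm (Fin n)} {k : Fin (n - 1)}
    (h : w (leftPos k) < w (rightPos k)) :
    inversionWeight Q f (w * adjSwap k) =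
      Q (f (leftPos k)) (f (rightPos k)) * inversionWeight Q (f ∘ adjSwap k) w :=
  prod_inversionPairs_mul_adjSwap h _

namespace YetterDrinfeld

variable {G V : Type*} [CommGroup G] [AddCommGroup V] [Module ℂ V]

theorem braidAction_σ (Y : YetterDrinfeld G V) [Module.Finite ℂ V] {n : ℕ} (k : Fin (n - 1)) :
    Y.braidAction n (BraidGroup.σ k) = Y.braidAt k := by
  simp [braidAction, BraidGroup.σ, braidUnit]

theorem IsDiagonal.braidAt_tprod {Y : YetterDrinfeld G V} [Module.Finite ℂ V] {n : ℕ}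
    {v : Module.Basis (Fin n) ℂ V} {g : Fin n → G} {χ : Fin n → G →* ℂˣ}
    (hY : Y.IsDiagonal v g χ) {m : ℕ} (k : Fin (m - 1)) (f : Fin m → Fin n) :
    Y.braidAt k (PiTensorProduct.tprod ℂ fun l => v (f l)) =
      (χ (f (rightPos k)) (g (f (leftPos k))) : ℂ) •
        PiTensorProduct.tprod ℂ fun l => v (f (adjSwap k l)) := by
  classical
  rw [Y.braidAt_tprod k _ (hY _).1]
  have : (fun l => if l = leftPos k then Y.action (g (f (leftPos k))) (v (f (rightPos k)))
      else if l = rightPos k then v (f (leftPos k)) else v (f l)) =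
      Function.update (fun l => v (f (adjSwap k l))) (leftPos k)
        ((χ (f (rightPos k)) (g (f (leftPos k))) : ℂ) • v (f (adjSwap k (leftPos k)))) := by
    funext l
    by_cases h1 : l = leftPos k
    · subst h1; simp [(hY _).2, adjSwap_leftPos]
    · rw [Function.update_of_ne h1, if_neg h1]
      by_cases h2 : l = rightPos k
      · subst h2; simp [adjSwap_rightPos]
      · rw [if_neg h2, adjSwap, Equiv.swap_apply_of_ne_of_ne h1 h2]
  rw [this, MultilinearMap.map_update_smul, Function.update_eq_self]

/-- The length hypothesis forces every letter to act at an ascent, so each braiding contributes the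
factor of exactly one new inversion. -/
theorem IsDiagonal.braidAction_word {Y : YetterDrinfeld G V} [Module.Finite ℂ V] {n : ℕ}
    {v : Module.Basis (Fin n) ℂ V} {g : Fin n → G} {χ : Fin n → G →* ℂˣ}
    (hY : Y.IsDiagonal v g χ) {Q : Matrix (Fin n) (Fin n) ℂ} (hQ : ∀ i j, Q i j = χ j (g i))
    {m : ℕ} (l : List (Fin (m - 1))) (f : Fin m → Fin n)
    (hl : l.length = (inversionPairs (l.map adjSwap).prod).card) :
    Y.braidAction m (l.map BraidGroup.σ).prod (PiTensorProduct.tprod ℂ fun a => v (f a)) =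
      inversionWeight Q f (l.map adjSwap).prod •
        PiTensorProduct.tprod ℂ fun a => v (f ((l.map adjSwap).prod⁻¹ a)) := by
  induction l using List.reverseRecOn generalizing f with
  | nil => simp [inversionWeight_one]
  | append_singleton l k ih =>
    rw [List.map_append, List.prod_append, List.map_singleton, List.prod_singleton,
      List.length_append, List.length_singleton] at hl
    have hle := card_inversionPairs_le l
    -- At a descent the shorter word would have more inversions than letters.
    have hk : (l.map adjSwap).prod (leftPos k) < (l.map adjSwap).prod (rightPos k) := by
      refine (leftPos_lt_or_rightPos_lt _ k).resolve_right fun h => ?_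
      have := card_inversionPairs_of_descent h
      omega
    rw [card_inversionPairs_mul_adjSwap hk] at hl
    rw [List.map_append, List.prod_append, List.map_singleton, List.prod_singleton,
      List.map_append, List.prod_append, List.map_singleton, List.prod_singleton,
      map_mul, Module.End.mul_apply, braidAction_σ, hY.braidAt_tprod, map_smul,
      ih (fun a => f (adjSwap k a)) (by omega), inversionWeight_mul_adjSwap Q f hk, smul_smul, hQ]
    simp [Function.comp_def, adjSwap]

/-- The action of the lift of `w` on tensors of basis vectors. -/
theorem IsDiagonal.braidAction_matsumotoLift {Y : YetterDrinfeld G V} [Module.Finite ℂ V] {n : ℕ}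
    {v : Module.Basis (Fin n) ℂ V} {g : Fin n → G} {χ : Fin n → G →* ℂˣ}
    (hY : Y.IsDiagonal v g χ) {Q : Matrix (Fin n) (Fin n) ℂ} (hQ : ∀ i j, Q i j = χ j (g i))
    {m : ℕ} (w : Equiv.Perm (Fin m)) (f : Fin m → Fin n) :
    Y.braidAction m (matsumotoLift w) (PiTensorProduct.tprod ℂ fun a => v (f a)) =
      inversionWeight Q f w • PiTensorProduct.tprod ℂ fun a => v (f (w⁻¹ a)) := by
  -- The chosen word enters only through its product and its length, so the choice does not affect
  -- the result.
  have hr := (exists_isReducedWord w).choose_spec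
  have := hY.braidAction_word hQ (exists_isReducedWord w).choose f (by rw [hr.1, hr.length_eq])
  rwa [hr.1] at this

end YetterDrinfeld

/-! ### The Dynkin operator on `v ⊗ ⋯ ⊗ v ⊗ w` -/

theorem cycleIcc_apply_val {n a d : ℕ} (h : a + d < n) (k : Fin n) :
    (Fin.cycleIcc ⟨a, by omega⟩ ⟨a + d, h⟩ k : ℕ) =
      if (k : ℕ) < a ∨ a + d < k then (k : ℕ) else if (k : ℕ) = a + d then a else k + 1 := by
  have : NeZero n := ⟨by omega⟩
  rcases lt_or_ge (k : ℕ) a with hk | hk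
  · rw [Fin.cycleIcc_of_lt (show k < ⟨a, _⟩ from hk), if_pos (Or.inl hk)]
  rcases lt_or_ge (a + d) (k : ℕ) with hk' | hk'
  · rw [Fin.cycleIcc_of_gt (show ⟨a + d, _⟩ < k from hk'), if_pos (Or.inr hk')]
  rw [if_neg (by omega)]
  rcases hk'.eq_or_lt with he | hlt
  · obtain rfl : k = ⟨a + d, h⟩ := Fin.ext he
    rw [Fin.cycleIcc_of_last (show (⟨a, _⟩ : Fin n) ≤ ⟨a + d, h⟩ from hk), if_pos rfl]
  · rw [Fin.cycleIcc_of_ge_of_lt (show ⟨a, _⟩ ≤ k from hk) (show k < ⟨a + d, _⟩ from hlt),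
      if_neg hlt.ne, Fin.val_add_one_of_lt' (by omega)]

/-- The transposition acts first and takes position `a` to `a + 1`; the shorter cycle takes it on to
the end. This allows weights to be computed one crossing at a time. -/
theorem cycleIcc_inv_succ {n a d : ℕ} (h : a + (d + 1) < n) :
    (Fin.cycleIcc ⟨a, by omega⟩ ⟨a + (d + 1), h⟩)⁻¹ =
      (Fin.cycleIcc ⟨a + 1, by omega⟩ ⟨a + 1 + d, by omega⟩)⁻¹ * adjSwap ⟨a, by omega⟩ := by
  rw [inv_eq_iff_eq_inv, mul_inv_rev, inv_inv]
  ext k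
  have hs : (adjSwap (n := n) ⟨a, by omega⟩)⁻¹ = adjSwap ⟨a, by omega⟩ := Equiv.swap_inv _ _
  rw [hs, Equiv.Perm.mul_apply, adjSwap_apply_val, cycleIcc_apply_val, cycleIcc_apply_val]
  simp only
  split_ifs <;> omega

theorem dynkinSet_apply_eq {n : ℕ} {d i : ℕ} (h : i + d < n) {p : ℤˣ × Equiv.Perm (Fin n)}
    (hp : p ∈ dynkinSet d i h) {k : Fin n} (hk : (k : ℕ) < i ∨ i + d < k) : p.2 k = k := by
  induction d generalizing i p with
  | zero => rw [dynkinSet, Finset.mem_singleton] at hp; rw [hp]; rfl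
  | succ d ih =>
    rw [dynkinSet, Finset.mem_union, Finset.mem_image] at hp
    rcases hp with hp | ⟨p', hp', rfl⟩
    · exact ih _ hp (by omega)
    · have hc : (Fin.cycleIcc ⟨i, by omega⟩ ⟨i + (d + 1), h⟩)⁻¹ k = k := by
        rw [Equiv.Perm.inv_eq_iff_eq]
        ext
        rw [cycleIcc_apply_val, if_pos hk]
      change p'.2 ((Fin.cycleIcc ⟨i, by omega⟩ ⟨i + (d + 1), h⟩)⁻¹ k) = k
      rw [hc]
      exact ih _ hp' (by omega)

/-- Members of the first set fix position `i`, while members of the second send it to `i + d + 1`.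
Hence the union in the recursion is a genuine sum. -/
theorem dynkinSet_disjoint {n : ℕ} {d i : ℕ} (h : i + (d + 1) < n) :
    Disjoint (dynkinSet d (i + 1) (by omega) : Finset (ℤˣ × Equiv.Perm (Fin n)))
      ((dynkinSet d i (by omega)).image
        (· * (-1, (Fin.cycleIcc ⟨i, by omega⟩ ⟨i + (d + 1), h⟩)⁻¹))) := by
  rw [Finset.disjoint_left]
  rintro p hp hp'
  obtain ⟨p', hp'', rfl⟩ := Finset.mem_image.1 hp'
  have h1 := dynkinSet_apply_eq _ hp (k := ⟨i, by omega⟩) (Or.inl (Nat.lt_succ_self i))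
  have h2 := dynkinSet_apply_eq _ hp'' (k := ⟨i + (d + 1), h⟩) (Or.inr (by simp))
  have hc : (Fin.cycleIcc ⟨i, by omega⟩ ⟨i + (d + 1), h⟩)⁻¹ ⟨i, by omega⟩ =
      (⟨i + (d + 1), h⟩ : Fin n) := by
    rw [Equiv.Perm.inv_eq_iff_eq]
    ext
    rw [cycleIcc_apply_val]
    simp
  change p'.2 ((Fin.cycleIcc ⟨i, by omega⟩ ⟨i + (d + 1), h⟩)⁻¹ ⟨i, by omega⟩) = _ at h1
  rw [hc, h2, Fin.mk.injEq] at h1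
  omega

theorem sum_dynkinSet_succ {M : Type*} [AddCommMonoid M] {n : ℕ} {d i : ℕ} (h : i + (d + 1) < n)
    (F : ℤˣ × Equiv.Perm (Fin n) → M) :
    ∑ p ∈ dynkinSet (d + 1) i h, F p = ∑ p ∈ dynkinSet d (i + 1) (by omega), F p +
      ∑ p ∈ dynkinSet d i (by omega),
        F (-p.1, p.2 * (Fin.cycleIcc ⟨i, by omega⟩ ⟨i + (d + 1), h⟩)⁻¹) := by
  rw [dynkinSet, Finset.sum_union (dynkinSet_disjoint h), Finset.sum_image]
  · congr 1
    refine Finset.sum_congr rfl fun p _ => ?_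
    congr 1
    ext <;> simp
  · exact (mul_left_injective _).injOn

/-- The word `i ⋯ i j i ⋯ i` with the letter `j` at position `p`. -/
def wordAt {ι : Type*} (i j : ι) (m p : ℕ) : Fin m → ι := fun k => if (k : ℕ) = p then j else i

theorem wordAt_of_ne {ι : Type*} (i j : ι) {m p : ℕ} {k : Fin m} (h : (k : ℕ) ≠ p) :
    wordAt i j m p k = i :=
  if_neg h

theorem wordAt_comp_adjSwap {ι : Type*} (i j : ι) {m p : ℕ} (k : Fin (m - 1)) :
    wordAt i j m p ∘ adjSwap k =
      wordAt i j m (if p = k then (k : ℕ) + 1 else if p = k + 1 then (k : ℕ) else p) := by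
  funext a
  simp only [wordAt, Function.comp_apply, adjSwap_apply_val]
  congr 1
  apply propext
  split_ifs <;> omega

theorem wordAt_comp_cycleIcc {ι : Type*} (i j : ι) {m a d : ℕ} (h : a + (d + 1) < m) :
    wordAt i j m (a + (d + 1)) ∘ Fin.cycleIcc ⟨a, by omega⟩ ⟨a + (d + 1), h⟩ =
      wordAt i j m (a + d) := by
  funext k
  simp only [wordAt, Function.comp_apply, cycleIcc_apply_val]
  congr 1
  apply propext
  split_ifs <;> omega

/-- The inverse cycle carries the letter at `a` across `d` letters `i` and then the letter `j`. As
`w` fixes all positions from `a + d + 1` on, none of these crossings is undone and the weights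
multiply. -/
theorem inversionWeight_mul_cycleIcc_inv {ι R : Type*} [CommMonoid R] (Q : Matrix ι ι R) (i j : ι)
    {m d a : ℕ} (h : a + (d + 1) < m) {w : Equiv.Perm (Fin m)}
    (hw : ∀ k : Fin m, a + (d + 1) ≤ k → w k = k) :
    inversionWeight Q (wordAt i j m (a + (d + 1)))
        (w * (Fin.cycleIcc ⟨a, by omega⟩ ⟨a + (d + 1), h⟩)⁻¹) =
      Q i i ^ d * Q i j * inversionWeight Q (wordAt i j m (a + d)) w := by
  induction d generalizing a with
  | zero =>
    have hc : (Fin.cycleIcc ⟨a, by omega⟩ ⟨a + (0 + 1), h⟩)⁻¹ =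
        (adjSwap ⟨a, by omega⟩ : Equiv.Perm (Fin m)) := by
      rw [cycleIcc_inv_succ]
      have : NeZero m := ⟨by omega⟩
      simp only [add_zero]
      rw [Fin.cycleIcc_eq, inv_one, one_mul]
    rw [hc, inversionWeight_mul_adjSwap, wordAt_comp_adjSwap]
    · simp [wordAt, leftPos, rightPos]
    · rw [hw (rightPos _) le_rfl]
      by_contra hlt
      have hlt : a + (0 + 1) ≤ (w (leftPos ⟨a, by omega⟩) : ℕ) := not_lt.1 hlt
      have := congrArg Fin.val (w.injective (hw _ hlt))
      simp only [leftPos] at this hlt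
      omega
  | succ d ih =>
    have ih := ih (a := a + 1) (by omega) (fun k hk => hw k (by omega))
    have hd : a + 1 + (d + 1) = a + (d + 1 + 1) := by omega
    have hd' : a + 1 + d = a + (d + 1) := by omega
    -- The transposition at `a` exchanges two letters `i`: the word is unchanged and a factor `Q i
    -- i` appears.
    rw [cycleIcc_inv_succ, ← mul_assoc, inversionWeight_mul_adjSwap, wordAt_comp_adjSwap,
      if_neg (by simp only; omega), if_neg (by simp only; omega)]
    · rw [hd'] at ih
      conv at ih in wordAt i j m (a + 1 + (d + 1)) => rw [hd]
      rw [ih, wordAt_of_ne, wordAt_of_ne, pow_succ']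
      · simp only [mul_assoc]
      · simp only [rightPos]; omega
      · simp only [leftPos]; omega
    · have h1 : (Fin.cycleIcc ⟨a + 1, by omega⟩ ⟨a + 1 + (d + 1), by omega⟩)⁻¹
          (leftPos ⟨a, by omega⟩) = (leftPos ⟨a, by omega⟩ : Fin m) := by
        rw [Equiv.Perm.inv_eq_iff_eq]
        ext
        rw [cycleIcc_apply_val, if_pos (Or.inl (by simp [leftPos]))]
      have h2 : (Fin.cycleIcc ⟨a + 1, by omega⟩ ⟨a + 1 + (d + 1), by omega⟩)⁻¹
          (rightPos ⟨a, by omega⟩) = (⟨a + 1 + (d + 1), by omega⟩ : Fin m) := by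
        rw [Equiv.Perm.inv_eq_iff_eq]
        ext
        rw [cycleIcc_apply_val]
        simp only [rightPos]
        split_ifs <;> omega
      rw [Equiv.Perm.mul_apply, Equiv.Perm.mul_apply, h1, h2, hw ⟨a + 1 + (d + 1), _⟩ hd.ge]
      by_contra hlt
      have hlt : a + 1 + (d + 1) ≤ (w (leftPos ⟨a, by omega⟩) : ℕ) := not_lt.1 hlt
      have := congrArg Fin.val (w.injective (hw (w (leftPos ⟨a, by omega⟩)) (by omega)))
      simp only [leftPos] at this hlt
      omega

/-- The iterated braided commutator: `y_0 = y` and `y_{d+1} = x y_d - q^d s y_d x`. -/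
def iteratedBracket {A : Type*} [Ring A] [Algebra ℂ A] (q s : ℂ) (x y : A) : ℕ → A
  | 0 => y
  | d + 1 => x * iteratedBracket q s x y d - (q ^ d * s) • (iteratedBracket q s x y d * x)

theorem prod_ofFn_wordAt {ι M : Type*} [Monoid M] (x : ι → M) (i j : ι) {m p : ℕ} (hp : p < m) :
    (List.ofFn fun k => x (wordAt i j m p k)).prod = x i ^ p * x j * x i ^ (m - 1 - p) := by
  have : (List.ofFn fun k => x (wordAt i j m p k)) =
      List.replicate p (x i) ++ x j :: List.replicate (m - 1 - p) (x i) := by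
    apply List.ext_getElem
    · simp; omega
    · intro k h1 h2
      rw [List.getElem_ofFn, List.getElem_append]
      simp only [wordAt, List.length_replicate, List.getElem_replicate, List.getElem_cons]
      split_ifs <;> first | rfl | omega
  rw [this]
  simp [mul_assoc]

/-! ### Dynkin sums as iterated braided commutators -/

namespace YetterDrinfeld

variable {G V : Type*} [CommGroup G] [AddCommGroup V] [Module ℂ V]

/-- Both halves of the recursion for `𝒫` give `y_d`: the first with one more `x` on its left, the
second with one more on its right, a sign and the weight `q^d s`. The outer powers of `x` are kept
general because the first half shifts `a`. -/
theorem IsDiagonal.sum_dynkinSet {Y : YetterDrinfeld G V} [Module.Finite ℂ V] {n : ℕ}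
    {v : Module.Basis (Fin n) ℂ V} {g : Fin n → G} {χ : Fin n → G →* ℂˣ}
    (hY : Y.IsDiagonal v g χ) {Q : Matrix (Fin n) (Fin n) ℂ} (hQ : ∀ i j, Q i j = χ j (g i))
    (i j : Fin n) {m d a : ℕ} (h : a + d < m) :
    ∑ p ∈ dynkinSet d a h, ((p.1 : ℤ) : ℂ) • TensorPower.toTensorAlgebra
        (Y.braidAction m (matsumotoLift p.2)
          (PiTensorProduct.tprod ℂ fun k => v (wordAt i j m (a + d) k))) =
      TensorAlgebra.ι ℂ (v i) ^ a *
        iteratedBracket (Q i i) (Q i j) (TensorAlgebra.ι ℂ (v i)) (TensorAlgebra.ι ℂ (v j)) d *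
        TensorAlgebra.ι ℂ (v i) ^ (m - 1 - (a + d)) := by
  simp only [hY.braidAction_matsumotoLift hQ, map_smul, TensorPower.toTensorAlgebra_tprod,
    TensorAlgebra.tprod_apply]
  induction d generalizing a with
  | zero =>
    rw [dynkinSet, Finset.sum_singleton]
    simp only [Prod.fst_one, Prod.snd_one, inversionWeight_one, inv_one, Equiv.Perm.one_apply]
    rw [prod_ofFn_wordAt (fun i => TensorAlgebra.ι ℂ (v i)) i j h]
    simp [iteratedBracket]
  | succ d ih =>
    -- The letter `j` is at the right end of the interval starting at `a + 1` as well, so the first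
    -- half concerns the same word.
    have hd : a + (d + 1) = a + 1 + d := by omega
    rw [sum_dynkinSet_succ]
    have h1 := ih (a := a + 1) (by omega)
    have h2 := ih (a := a) (by omega)
    simp only [← hd] at h1
    rw [h1]
    have h3 : ∀ p ∈ (dynkinSet d a (by omega) : Finset (ℤˣ × Equiv.Perm (Fin m))),
        (((-p.1 : ℤˣ) : ℤ) : ℂ) • inversionWeight Q (wordAt i j m (a + (d + 1)))
            (p.2 * (Fin.cycleIcc ⟨a, by omega⟩ ⟨a + (d + 1), h⟩)⁻¹) •
          (List.ofFn fun k => TensorAlgebra.ι ℂ (v (wordAt i j m (a + (d + 1))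
            ((p.2 * (Fin.cycleIcc ⟨a, by omega⟩ ⟨a + (d + 1), h⟩)⁻¹)⁻¹ k)))).prod =
        (-(Q i i ^ d * Q i j)) • (((p.1 : ℤ) : ℂ) • inversionWeight Q (wordAt i j m (a + d)) p.2 •
          (List.ofFn fun k => TensorAlgebra.ι ℂ (v (wordAt i j m (a + d) (p.2⁻¹ k)))).prod) := by
      intro p hp
      rw [inversionWeight_mul_cycleIcc_inv Q i j h fun k hk =>
        dynkinSet_apply_eq _ hp (Or.inr (by omega))]
      simp only [← wordAt_comp_cycleIcc i j h, mul_inv_rev, inv_inv, Equiv.Perm.mul_apply,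
        Function.comp_apply, smul_smul]
      congr 1
      push_cast
      ring
    rw [Finset.sum_congr rfl h3, ← Finset.smul_sum, h2, iteratedBracket, pow_succ]
    have he : m - 1 - (a + d) = m - 1 - (a + (d + 1)) + 1 := by omega
    rw [he, pow_succ', neg_smul, ← sub_eq_add_neg]
    simp only [mul_sub, sub_mul, mul_assoc, smul_mul_assoc, mul_smul_comm]

/-- The element `P_{N+1}(v_i^N v_j)` is an iterated braided commutator. -/
theorem IsDiagonal.dynkinElement_eq {Y : YetterDrinfeld G V} [Module.Finite ℂ V] {n : ℕ}
    {v : Module.Basis (Fin n) ℂ V} {g : Fin n → G} {χ : Fin n → G →* ℂˣ}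
    (hY : Y.IsDiagonal v g χ) {Q : Matrix (Fin n) (Fin n) ℂ} (hQ : ∀ i j, Q i j = χ j (g i))
    (i j : Fin n) (N : ℕ) :
    Y.dynkinElement N (v i) (v j) =
      iteratedBracket (Q i i) (Q i j) (TensorAlgebra.ι ℂ (v i)) (TensorAlgebra.ι ℂ (v j)) N := by
  have hf : (Fin.snoc (fun _ : Fin N => v i) (v j) : Fin (N + 1) → V) =
      fun k => v (wordAt i j (N + 1) (0 + N) k) := by
    funext k
    refine Fin.lastCases ?_ (fun k => ?_) k
    · simp [wordAt]
    · simp [wordAt, k.isLt.ne]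
  have h := hY.sum_dynkinSet hQ i j (m := N + 1) (d := N) (a := 0) (by omega)
  rw [pow_zero, one_mul, show N + 1 - 1 - (0 + N) = 0 by omega, pow_zero, mul_one] at h
  rw [← h, dynkinElement, hf, dynkinOperator, dynkinSum]
  simp only [matsumoto, map_sum, MonoidAlgebra.mapDomainLinearMap_single,
    Representation.asAlgebraHom_single, LinearMap.sum_apply, LinearMap.smul_apply, map_smul]

end YetterDrinfeld

/-! ### Gaussian binomials and the coproduct of iterated braided commutators -/

/-- The Gaussian binomial coefficient `[k + e choose k]` as a polynomial in `q`. -/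
def gaussianBinomial (q : ℂ) : ℕ → ℕ → ℂ
  | 0, _ => 1
  | _ + 1, 0 => 1
  | k + 1, e + 1 => gaussianBinomial q k (e + 1) + q ^ (k + 1) * gaussianBinomial q (k + 1) e

theorem gaussianBinomial_zero_left (q : ℂ) (e : ℕ) : gaussianBinomial q 0 e = 1 := by
  rw [gaussianBinomial]

theorem gaussianBinomial_zero_right (q : ℂ) (k : ℕ) : gaussianBinomial q k 0 = 1 := by
  cases k <;> rw [gaussianBinomial]

theorem gaussianBinomial_succ_succ (q : ℂ) (k e : ℕ) :
    gaussianBinomial q (k + 1) (e + 1) =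
      gaussianBinomial q k (e + 1) + q ^ (k + 1) * gaussianBinomial q (k + 1) e := by
  rw [gaussianBinomial]

/-- The defining recursion is not symmetric in `k` and `e`, so the mirror Pascal rule needs proof.
Applying the two rules in either order leads to the same expression in smaller coefficients. -/
theorem gaussianBinomial_succ_succ' (q : ℂ) (k e : ℕ) :
    gaussianBinomial q (k + 1) (e + 1) =
      gaussianBinomial q (k + 1) e + q ^ (e + 1) * gaussianBinomial q k (e + 1) := by
  induction k generalizing e with
  | zero =>
    induction e with
    | zero => simp [gaussianBinomial_succ_succ, gaussianBinomial_zero_left, gaussianBinomial_zero_right]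
    | succ e ih =>
      rw [gaussianBinomial_succ_succ, gaussianBinomial_zero_left]
      rw [gaussianBinomial_zero_left] at ih
      have h := gaussianBinomial_succ_succ q 0 e
      rw [gaussianBinomial_zero_left] at h
      linear_combination q * ih - h
  | succ k ihk =>
    induction e with
    | zero =>
      have h1 := gaussianBinomial_succ_succ q (k + 1) 0
      have h2 := gaussianBinomial_succ_succ q k 0
      have h3 := ihk 0
      simp only [gaussianBinomial_zero_right] at *
      linear_combination h1 + h3 - q * h2
    | succ e ihe =>
      have h1 := gaussianBinomial_succ_succ q (k + 1) (e + 1)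
      have h2 := gaussianBinomial_succ_succ q (k + 1) e
      have h3 := gaussianBinomial_succ_succ q k (e + 1)
      have h4 := ihk (e + 1)
      linear_combination h1 + h4 + q ^ (k + 2) * ihe - h2 - q ^ (e + 2) * h3

/-- The coefficient of `x^k ⊗ y_e` in the coproduct of `y_{k+e}`. -/
def comulCoeff (q r : ℂ) (k e : ℕ) : ℂ :=
  gaussianBinomial q k e * ∏ l ∈ Finset.range k, (1 - q ^ (e + l) * r)

theorem comulCoeff_zero_left (q r : ℂ) (e : ℕ) : comulCoeff q r 0 e = 1 := by
  simp [comulCoeff, gaussianBinomial_zero_left]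

theorem comulCoeff_succ_zero (q r : ℂ) (k : ℕ) :
    comulCoeff q r (k + 1) 0 = (1 - q ^ k * r) * comulCoeff q r k 0 := by
  simp only [comulCoeff, gaussianBinomial_zero_right, Finset.prod_range_succ, zero_add]
  ring

/-- After the common product is removed, the parts of degree 0 and 1 in the remaining explicit `r`
are the two Pascal rules. -/
theorem comulCoeff_succ_succ (q r : ℂ) (k e : ℕ) :
    comulCoeff q r (k + 1) (e + 1) =
      (1 - q ^ (k + 2 * (e + 1)) * r) * comulCoeff q r k (e + 1) +
        q ^ (k + 1) * comulCoeff q r (k + 1) e := by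
  have h1 : ∏ l ∈ Finset.range (k + 1), (1 - q ^ (e + l) * r) =
      (1 - q ^ e * r) * ∏ l ∈ Finset.range k, (1 - q ^ (e + 1 + l) * r) := by
    rw [Finset.prod_range_succ', mul_comm, add_zero]
    congr 1
    refine Finset.prod_congr rfl fun l _ => ?_
    rw [add_assoc, add_comm 1 l]
  rw [comulCoeff, comulCoeff, comulCoeff, h1, Finset.prod_range_succ]
  have h2 := gaussianBinomial_succ_succ q k e
  have h3 := gaussianBinomial_succ_succ' q k e
  set P := ∏ l ∈ Finset.range k, (1 - q ^ (e + 1 + l) * r)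
  linear_combination P * h2 - P * q ^ (e + 1 + k) * r * h3

/-- The coefficients with `k ≥ 1` vanish as soon as `q^{k+e-1} r = 1`. -/
theorem comulCoeff_succ_eq_zero {q r : ℂ} {k e : ℕ} (h : q ^ (k + e) * r = 1) :
    comulCoeff q r (k + 1) e = 0 := by
  rw [comulCoeff, Finset.prod_eq_zero (Finset.self_mem_range_succ k), mul_zero]
  rw [add_comm e k, h, sub_self]

/-! ### Coproducts in the braided tensor square -/

namespace YetterDrinfeld

variable {G V : Type*} [CommGroup G] [AddCommGroup V] [Module ℂ V]

theorem tmul_mul_tmul (Y : YetterDrinfeld G V) {g : G} {b : TensorAlgebra ℂ V}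
    (hb : Y.IsTensorHomogeneous g b) (a c d : TensorAlgebra ℂ V) :
    Y.tmul a b * Y.tmul c d = Y.tmul (a * Y.tensorAction g c) (b * d) :=
  Y.braidedMul_tmul hb a c d

theorem smul_tmul (Y : YetterDrinfeld G V) (r : ℂ) (a b : TensorAlgebra ℂ V) :
    Y.tmul (r • a) b = r • Y.tmul a b := by
  rw [tmul, tmul, ← map_smul, TensorProduct.smul_tmul']

theorem tmul_smul (Y : YetterDrinfeld G V) (r : ℂ) (a b : TensorAlgebra ℂ V) :
    Y.tmul a (r • b) = r • Y.tmul a b := by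
  rw [tmul, tmul, ← map_smul, TensorProduct.tmul_smul]

theorem sub_tmul (Y : YetterDrinfeld G V) (a a' b : TensorAlgebra ℂ V) :
    Y.tmul (a - a') b = Y.tmul a b - Y.tmul a' b := by
  simp only [tmul, TensorProduct.sub_tmul, map_sub]

theorem tmul_sub (Y : YetterDrinfeld G V) (a b b' : TensorAlgebra ℂ V) :
    Y.tmul a (b - b') = Y.tmul a b - Y.tmul a b' := by
  simp only [tmul, TensorProduct.tmul_sub, map_sub]

theorem comul_ι (Y : YetterDrinfeld G V) (v : V) :
    Y.comul (TensorAlgebra.ι ℂ v) =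
      Y.tmul (TensorAlgebra.ι ℂ v) 1 + Y.tmul 1 (TensorAlgebra.ι ℂ v) := by
  simp [comul, tmul]

theorem IsTensorHomogeneous.sub {Y : YetterDrinfeld G V} {g : G} {x y : TensorAlgebra ℂ V}
    (hx : Y.IsTensorHomogeneous g x) (hy : Y.IsTensorHomogeneous g y) :
    Y.IsTensorHomogeneous g (x - y) := by
  rw [IsTensorHomogeneous] at *
  rw [map_sub, hx, hy, ← MonoidAlgebra.single_sub]

theorem IsTensorHomogeneous.smul {Y : YetterDrinfeld G V} {g : G} {x : TensorAlgebra ℂ V}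
    (hx : Y.IsTensorHomogeneous g x) (r : ℂ) : Y.IsTensorHomogeneous g (r • x) := by
  rw [IsTensorHomogeneous] at *
  rw [map_smul, hx, MonoidAlgebra.smul_single]

theorem isTensorHomogeneous_iteratedBracket {Y : YetterDrinfeld G V} {g h : G}
    {x y : TensorAlgebra ℂ V} (hx : Y.IsTensorHomogeneous g x) (hy : Y.IsTensorHomogeneous h y)
    (q s : ℂ) (d : ℕ) : Y.IsTensorHomogeneous (g ^ d * h) (iteratedBracket q s x y d) := by
  induction d with
  | zero => simpa [iteratedBracket] using hy
  | succ d ih =>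
    have h1 := hx.mul ih
    have h2 := ih.mul hx
    rw [mul_comm _ g] at h2
    rw [pow_succ', mul_assoc, iteratedBracket]
    exact h1.sub (h2.smul _)

theorem tensorAction_iteratedBracket {Y : YetterDrinfeld G V} {g : G}
    {x y : TensorAlgebra ℂ V} {q s : ℂ} (hx : Y.tensorAction g x = q • x)
    (hy : Y.tensorAction g y = s • y) (d : ℕ) :
    Y.tensorAction g (iteratedBracket q s x y d) = (q ^ d * s) • iteratedBracket q s x y d := by
  induction d with
  | zero => simpa [iteratedBracket] using hy
  | succ d ih =>
    simp only [iteratedBracket, map_sub, map_smul, map_mul, hx, ih, smul_sub, smul_smul,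
      smul_mul_assoc, mul_smul_comm]
    ring_nf

theorem tensorAction_pow {Y : YetterDrinfeld G V} {g : G} {x : TensorAlgebra ℂ V} {q : ℂ}
    (hx : Y.tensorAction g x = q • x) (d : ℕ) : Y.tensorAction g (x ^ d) = q ^ d • x ^ d := by
  rw [map_pow, hx, smul_pow]

theorem tensorAction_pow_mul {Y : YetterDrinfeld G V} {g h : G} {x : TensorAlgebra ℂ V} {q t : ℂ}
    (hx : Y.tensorAction g x = q • x) (hx' : Y.tensorAction h x = t • x) (d : ℕ) :
    Y.tensorAction (g ^ d * h) x = (q ^ d * t) • x := by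
  induction d with
  | zero => simpa using hx'
  | succ d ih =>
    rw [pow_succ', mul_assoc, tensorAction_mul, ih, map_smul, hx, smul_smul]
    ring_nf

/-- The braided commutator of `Δ x` with a term `x^k ⊗ y_e`. -/
theorem bracket_tmul {Y : YetterDrinfeld G V} {g h : G} {x y : TensorAlgebra ℂ V}
    (hx : Y.IsTensorHomogeneous g x) (hy : Y.IsTensorHomogeneous h y) {q s t : ℂ}
    (hxx : Y.tensorAction g x = q • x) (hyx : Y.tensorAction h x = t • x) (k e : ℕ) :
    (Y.tmul x 1 + Y.tmul 1 x) * Y.tmul (x ^ k) (iteratedBracket q s x y e) -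
        (q ^ (k + e) * s) •
          (Y.tmul (x ^ k) (iteratedBracket q s x y e) * (Y.tmul x 1 + Y.tmul 1 x)) =
      (1 - q ^ (k + 2 * e) * (s * t)) • Y.tmul (x ^ (k + 1)) (iteratedBracket q s x y e) +
        q ^ k • Y.tmul (x ^ k) (iteratedBracket q s x y (e + 1)) := by
  -- Since `y_e` has degree `g^e h`, moving it past `x` costs `q^e t`; moving `x` past `x^k` costs
  -- `q^k`.
  have hB := isTensorHomogeneous_iteratedBracket hx hy q s e
  simp only [add_mul, mul_add, Y.tmul_mul_tmul hB, Y.tmul_mul_tmul Y.isTensorHomogeneous_one,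
    Y.tmul_mul_tmul hx, tensorAction_one, AlgHom.id_apply, tensorAction_pow hxx,
    tensorAction_pow_mul hxx hyx, map_one, one_mul, mul_one, ← pow_succ', mul_smul_comm,
    ← pow_succ, smul_tmul, iteratedBracket, tmul_sub, tmul_smul]
  module

/-- As `Δ` is multiplicative, `Δ(y_{d+1})` is the commutator of `Δ(x)` with `Δ(y_d)`. By
`bracket_tmul` each `x^k ⊗ y_e` feeds `x^{k+1} ⊗ y_e` and `x^k ⊗ y_{e+1}`, which gives the recursion
of `comulCoeff`. -/
theorem comul_iteratedBracket {Y : YetterDrinfeld G V} {g h : G} {x y : TensorAlgebra ℂ V}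
    (hx : Y.IsTensorHomogeneous g x) (hy : Y.IsTensorHomogeneous h y)
    (hΔx : Y.IsPrimitive x) (hΔy : Y.IsPrimitive y) {q s t : ℂ}
    (hxx : Y.tensorAction g x = q • x) (hxy : Y.tensorAction g y = s • y)
    (hyx : Y.tensorAction h x = t • x) (d : ℕ) :
    Y.comul (iteratedBracket q s x y d) = Y.tmul (iteratedBracket q s x y d) 1 +
      ∑ p ∈ Finset.HasAntidiagonal.antidiagonal d, comulCoeff q (s * t) p.1 p.2 •
        Y.tmul (x ^ p.1) (iteratedBracket q s x y p.2) := by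
  induction d with
  | zero => simpa [iteratedBracket, comulCoeff_zero_left, IsPrimitive] using hΔy
  | succ d ih =>
    -- The terms `y_d ⊗ x` cancel because `g` acts on `y_d` by `q^d s`, the constant of the
    -- commutator.
    have hleft : (Y.tmul x 1 + Y.tmul 1 x) * Y.tmul (iteratedBracket q s x y d) 1 -
        (q ^ d * s) • (Y.tmul (iteratedBracket q s x y d) 1 * (Y.tmul x 1 + Y.tmul 1 x)) =
        Y.tmul (iteratedBracket q s x y (d + 1)) 1 := by
      simp only [add_mul, mul_add, Y.tmul_mul_tmul Y.isTensorHomogeneous_one,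
        Y.tmul_mul_tmul hx, tensorAction_one, AlgHom.id_apply,
        tensorAction_iteratedBracket hxx hxy, map_one, one_mul, mul_one, smul_tmul,
        iteratedBracket, sub_tmul]
      module
    have hterm : ∀ p ∈ Finset.HasAntidiagonal.antidiagonal d,
        (Y.tmul x 1 + Y.tmul 1 x) * (comulCoeff q (s * t) p.1 p.2 •
            Y.tmul (x ^ p.1) (iteratedBracket q s x y p.2)) -
          (q ^ d * s) • ((comulCoeff q (s * t) p.1 p.2 •
            Y.tmul (x ^ p.1) (iteratedBracket q s x y p.2)) * (Y.tmul x 1 + Y.tmul 1 x)) =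
        (comulCoeff q (s * t) p.1 p.2 * (1 - q ^ (p.1 + 2 * p.2) * (s * t))) •
            Y.tmul (x ^ (p.1 + 1)) (iteratedBracket q s x y p.2) +
          (comulCoeff q (s * t) p.1 p.2 * q ^ p.1) •
            Y.tmul (x ^ p.1) (iteratedBracket q s x y (p.2 + 1)) := by
      intro p hp
      rw [← Finset.HasAntidiagonal.mem_antidiagonal.1 hp, mul_smul (comulCoeff q (s * t) p.1 p.2),
        mul_smul (comulCoeff q (s * t) p.1 p.2), ← smul_add,
        ← bracket_tmul hx hy hxx hyx p.1 p.2, mul_smul_comm, smul_mul_assoc, smul_sub,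
        smul_comm (comulCoeff q (s * t) p.1 p.2)]
    -- `A` and `B` are the contributions to `x^k ⊗ y_e` from `x^{k-1} ⊗ y_e` and from `x^k ⊗
    -- y_{e-1}`, set to zero where no such term exists.
    let A : ℕ × ℕ → ℂ
      | (0, _) => 0
      | (k + 1, e) => comulCoeff q (s * t) k e * (1 - q ^ (k + 2 * e) * (s * t))
    let B : ℕ × ℕ → ℂ
      | (_, 0) => 0
      | (k, e + 1) => comulCoeff q (s * t) k e * q ^ k
    have hAB : ∀ p ∈ Finset.HasAntidiagonal.antidiagonal (d + 1), comulCoeff q (s * t) p.1 p.2 = A p + B p := by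
      rintro ⟨_ | k, _ | e⟩ hp
      · simp at hp
      · simp [A, B, comulCoeff_zero_left]
      · simp [A, B, comulCoeff_succ_zero, mul_comm]
      · simp only [A, B, comulCoeff_succ_succ]
        ring
    have hsum : ∑ p ∈ Finset.HasAntidiagonal.antidiagonal (d + 1), comulCoeff q (s * t) p.1 p.2 •
          Y.tmul (x ^ p.1) (iteratedBracket q s x y p.2) =
        ∑ p ∈ Finset.HasAntidiagonal.antidiagonal d,
          ((comulCoeff q (s * t) p.1 p.2 * (1 - q ^ (p.1 + 2 * p.2) * (s * t))) •
            Y.tmul (x ^ (p.1 + 1)) (iteratedBracket q s x y p.2) +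
          (comulCoeff q (s * t) p.1 p.2 * q ^ p.1) •
            Y.tmul (x ^ p.1) (iteratedBracket q s x y (p.2 + 1))) := by
      rw [Finset.sum_congr rfl fun p hp => by rw [hAB p hp, add_smul], Finset.sum_add_distrib,
        Finset.sum_add_distrib, Finset.Nat.sum_antidiagonal_succ,
        Finset.Nat.sum_antidiagonal_succ']
      simp [A, B]
    rw [hsum, ← Finset.sum_congr rfl hterm, Finset.sum_sub_distrib, ← Finset.mul_sum,
      ← Finset.smul_sum, ← Finset.sum_mul, ← hleft]
    conv_lhs => rw [iteratedBracket, map_sub, map_smul, map_mul, map_mul, ih, hΔx]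
    rw [mul_add (Y.tmul x 1 + Y.tmul 1 x), add_mul (Y.tmul (iteratedBracket q s x y d) 1), smul_add]
    abel

/-- The iterated braided commutator `y_{d+1}` is primitive if `q^d s t = 1`. -/
theorem isPrimitive_iteratedBracket {Y : YetterDrinfeld G V} {g h : G} {x y : TensorAlgebra ℂ V}
    (hx : Y.IsTensorHomogeneous g x) (hy : Y.IsTensorHomogeneous h y)
    (hΔx : Y.IsPrimitive x) (hΔy : Y.IsPrimitive y) {q s t : ℂ}
    (hxx : Y.tensorAction g x = q • x) (hxy : Y.tensorAction g y = s • y)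
    (hyx : Y.tensorAction h x = t • x) {d : ℕ} (hd : q ^ d * (s * t) = 1) :
    Y.IsPrimitive (iteratedBracket q s x y (d + 1)) := by
  rw [IsPrimitive, comul_iteratedBracket hx hy hΔx hΔy hxx hxy hyx,
    Finset.Nat.sum_antidiagonal_succ, Finset.sum_eq_zero fun p hp => ?_]
  · simp [comulCoeff_zero_left]
  · rw [comulCoeff_succ_eq_zero (by rw [Finset.HasAntidiagonal.mem_antidiagonal.1 hp, hd]), zero_smul]

theorem IsDiagonal.isPrimitive_iteratedBracket {Y : YetterDrinfeld G V} {n : ℕ}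
    {v : Module.Basis (Fin n) ℂ V} {g : Fin n → G} {χ : Fin n → G →* ℂˣ}
    (hY : Y.IsDiagonal v g χ) {Q : Matrix (Fin n) (Fin n) ℂ} (hQ : ∀ i j, Q i j = χ j (g i))
    (i j : Fin n) {d : ℕ} (hd : Q i i ^ d * (Q i j * Q j i) = 1) :
    Y.IsPrimitive (iteratedBracket (Q i i) (Q i j) (TensorAlgebra.ι ℂ (v i))
      (TensorAlgebra.ι ℂ (v j)) (d + 1)) := by
  have hact : ∀ k l, Y.tensorAction (g k) (TensorAlgebra.ι ℂ (v l)) =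
      Q k l • TensorAlgebra.ι ℂ (v l) := fun k l => by
    simp [tensorAction, (hY l).2, hQ]
  exact YetterDrinfeld.isPrimitive_iteratedBracket (Y.isTensorHomogeneous_ι (hY i).1)
    (Y.isTensorHomogeneous_ι (hY j).1) (Y.comul_ι _) (Y.comul_ι _) (hact i i) (hact i j)
    (hact j i) hd

end YetterDrinfeld

/-! ### Quantized Serre elements as iterated braided commutators -/

/-- If `p^m = p^{-m}` then `p^{2m} = 1`; the case `m = 1` handles the denominator. -/
theorem quantumInt_ne_zero {p : ℂ} (h0 : p ≠ 0) (hp : ∀ m : ℕ, 1 ≤ m → p ^ m ≠ 1) {m : ℕ}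
    (hm : 1 ≤ m) : quantumInt p m ≠ 0 := by
  have key : ∀ m : ℕ, 1 ≤ m → p ^ m - p⁻¹ ^ m ≠ 0 := by
    intro m hm h
    rw [sub_eq_zero, inv_pow] at h
    have := hp (2 * m) (by omega)
    rw [two_mul, pow_add] at this
    nth_rw 2 [h] at this
    exact this (mul_inv_cancel₀ (pow_ne_zero _ h0))
  exact div_ne_zero (key m hm) (by simpa using key 1 le_rfl)

theorem quantumFactorial_ne_zero {p : ℂ} (h0 : p ≠ 0) (hp : ∀ m : ℕ, 1 ≤ m → p ^ m ≠ 1) (m : ℕ) :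
    quantumFactorial p m ≠ 0 :=
  Finset.prod_ne_zero_iff.2 fun _ _ => quantumInt_ne_zero h0 hp (by omega)

theorem quantumFactorial_succ (p : ℂ) (m : ℕ) :
    quantumFactorial p (m + 1) = quantumFactorial p m * quantumInt p (m + 1) :=
  Finset.prod_range_succ _ _

theorem quantumBinomial_zero {p : ℂ} (h0 : p ≠ 0) (hp : ∀ m : ℕ, 1 ≤ m → p ^ m ≠ 1) (m : ℕ) :
    quantumBinomial p m 0 = 1 := by
  have h := quantumFactorial_ne_zero h0 hp m
  have h1 : quantumFactorial p 0 = 1 := Finset.prod_range_zero _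
  simp [quantumBinomial, h1, h]

theorem quantumBinomial_self {p : ℂ} (h0 : p ≠ 0) (hp : ∀ m : ℕ, 1 ≤ m → p ^ m ≠ 1) (m : ℕ) :
    quantumBinomial p m m = 1 := by
  have h := quantumFactorial_ne_zero h0 hp m
  have h1 : quantumFactorial p 0 = 1 := Finset.prod_range_zero _
  simp [quantumBinomial, h1, h]

theorem quantumInt_add {p : ℂ} (h0 : p ≠ 0) (a b : ℕ) :
    quantumInt p (a + b) = p⁻¹ ^ a * quantumInt p b + p ^ b * quantumInt p a := by
  simp only [quantumInt]
  rw [← mul_div_assoc, ← mul_div_assoc, ← add_div]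
  congr 1
  simp only [inv_pow, pow_add]
  field_simp
  ring

/-- The Pascal rule for quantum binomial coefficients. -/
theorem quantumBinomial_succ {p : ℂ} (h0 : p ≠ 0) (hp : ∀ m : ℕ, 1 ≤ m → p ^ m ≠ 1) (k e : ℕ) :
    quantumBinomial p (k + e + 2) (k + 1) =
      p⁻¹ ^ (k + 1) * quantumBinomial p (k + e + 1) (k + 1) +
        p ^ (e + 1) * quantumBinomial p (k + e + 1) k := by
  have h1 := quantumInt_ne_zero h0 hp (m := k + 1) (by omega)
  have h2 := quantumInt_ne_zero h0 hp (m := e + 1) (by omega)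
  have h3 := quantumFactorial_ne_zero h0 hp k
  have h4 := quantumFactorial_ne_zero h0 hp e
  have e1 : k + e + 2 - (k + 1) = e + 1 := by omega
  have e2 : k + e + 1 - (k + 1) = e := by omega
  have e3 : k + e + 1 - k = e + 1 := by omega
  have h5 : quantumInt p (k + e + 1 + 1) =
      p⁻¹ ^ (k + 1) * quantumInt p (e + 1) + p ^ (e + 1) * quantumInt p (k + 1) := by
    rw [← quantumInt_add h0]; congr 1; omega
  simp only [quantumBinomial, e1, e2, e3]
  rw [quantumFactorial_succ p (k + e + 1), h5, quantumFactorial_succ p k, quantumFactorial_succ p e]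
  generalize p⁻¹ ^ (k + 1) = u at *
  field_simp

/-- The index shift that combines the expansions of `x y_d` and `y_d x` into that of `y_{d+1}`. -/
theorem sum_range_sub_sum_range {A : Type*} [AddCommGroup A] {a b c : ℕ → A} {d : ℕ}
    (h0 : c 0 = a 0) (hmid : ∀ k ∈ Finset.range d, c (k + 1) = a (k + 1) - b k)
    (hlast : c (d + 1) = -b d) :
    ∑ k ∈ Finset.range (d + 1), a k - ∑ k ∈ Finset.range (d + 1), b k =
      ∑ k ∈ Finset.range (d + 2), c k := by
  rw [Finset.sum_range_succ' a, Finset.sum_range_succ b, Finset.sum_range_succ' c,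
    Finset.sum_range_succ _ d, hlast, h0, Finset.sum_congr rfl hmid, Finset.sum_sub_distrib]
  abel

/-- Expansion of the iterated braided commutator, for `q = p²` and `s = p^c`. -/
theorem iteratedBracket_eq_sum {A : Type*} [Ring A] [Algebra ℂ A] {p : ℂ} (h0 : p ≠ 0)
    (hp : ∀ m : ℕ, 1 ≤ m → p ^ m ≠ 1) (c : ℤ) (x y : A) (d : ℕ) :
    iteratedBracket (p ^ 2) (p ^ c) x y d = ∑ k ∈ Finset.range (d + 1),
      ((-1) ^ k * quantumBinomial p d k * p ^ ((k : ℤ) * (d - 1 + c))) •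
        (x ^ (d - k) * y * x ^ k) := by
  induction d with
  | zero => simp [iteratedBracket, quantumBinomial_zero h0 hp]
  | succ d ih =>
    rw [iteratedBracket, ih, Finset.mul_sum, Finset.sum_mul, Finset.smul_sum]
    refine sum_range_sub_sum_range ?_ ?_ ?_
    · simp [quantumBinomial_zero h0 hp, pow_succ', mul_assoc]
    · intro k hk
      obtain ⟨e, rfl⟩ : ∃ e, d = k + e + 1 := ⟨d - k - 1, by have := Finset.mem_range.1 hk; omega⟩
      have e1 : k + e + 1 + 1 - (k + 1) = e + 1 := by omega
      have e2 : k + e + 1 - (k + 1) = e := by omega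
      have e3 : k + e + 1 - k = e + 1 := by omega
      -- The powers `p^{-(k+1)}` and `p^{e+1}` of the Pascal rule correct the exponent for `y_{d+1}`
      -- to those for `x y_d` and for `q^d s y_d x`.
      have hz1 : p ^ (((k + 1 : ℕ) : ℤ) * ((k + e + 1 + 1 : ℕ) - 1 + c)) * p⁻¹ ^ (k + 1) =
          p ^ (((k + 1 : ℕ) : ℤ) * ((k + e + 1 : ℕ) - 1 + c)) := by
        rw [← zpow_natCast p⁻¹, inv_zpow', ← zpow_add₀ h0]
        congr 1; push_cast; ring
      have hz2 : p ^ (((k + 1 : ℕ) : ℤ) * ((k + e + 1 + 1 : ℕ) - 1 + c)) * p ^ (e + 1) =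
          (p ^ 2) ^ (k + e + 1) * p ^ c * p ^ ((k : ℤ) * ((k + e + 1 : ℕ) - 1 + c)) := by
        rw [← pow_mul, ← zpow_natCast p, ← zpow_natCast p, ← zpow_add₀ h0, ← zpow_add₀ h0,
          ← zpow_add₀ h0]
        congr 1; push_cast; ring
      rw [e1, e2, e3, quantumBinomial_succ h0 hp, mul_smul_comm, smul_mul_assoc, smul_smul,
        mul_assoc _ (x ^ k) x, ← pow_succ, ← mul_assoc x, ← mul_assoc x, ← pow_succ', ← sub_smul]
      congr 1
      rw [← hz1]
      linear_combination (-1) ^ (k + 1) * quantumBinomial p (k + e + 1) k * hz2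
    · have hz : p ^ (((d + 1 : ℕ) : ℤ) * ((d + 1 : ℕ) - 1 + c)) =
          (p ^ 2) ^ d * p ^ c * p ^ ((d : ℤ) * (d - 1 + c)) := by
        rw [← pow_mul, ← zpow_natCast p, ← zpow_add₀ h0, ← zpow_add₀ h0]
        congr 1; push_cast; ring
      rw [hz, quantumBinomial_self h0 hp, quantumBinomial_self h0 hp, smul_mul_assoc, smul_smul,
        ← neg_smul, Nat.sub_self, Nat.sub_self, mul_assoc _ (x ^ d) x, ← pow_succ]
      congr 1
      ring

theorem iteratedBracket_eq_serreElement {A : Type*} [Ring A] [Algebra ℂ A] {p : ℂ} (h0 : p ≠ 0)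
    (hp : ∀ m : ℕ, 1 ≤ m → p ^ m ≠ 1) {c : ℤ} (hc : c ≤ 0) (x y : A) :
    iteratedBracket (p ^ 2) (p ^ c) x y (1 - c).toNat = serreElement p (1 - c).toNat x y := by
  rw [iteratedBracket_eq_sum h0 hp, serreElement]
  refine Finset.sum_congr rfl fun k _ => ?_
  -- As `c ≤ 0`, the truncation is harmless and the exponent `k(d - 1 + c)` is zero at `d = 1 - c`.
  rw [show (((1 - c).toNat : ℤ) - 1 + c) = 0 by omega, mul_zero, zpow_zero, mul_one]

theorem mainTheorem8 {G V : Type*} [CommGroup G] [AddCommGroup V] [Module ℂ V] [Module.Finite ℂ V]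
    (Y : YetterDrinfeld G V) {n : ℕ} (v : Module.Basis (Fin n) ℂ V)
    (g : Fin n → G) (χ : Fin n → G →* ℂˣ) (hY : Y.IsDiagonal v g χ)
    (Q : Matrix (Fin n) (Fin n) ℂ) (hQ : ∀ i j, Q i j = χ j (g i)) :
    (∀ (i j : Fin n) (c : ℤ), i ≠ j →
      IsLeast {m : ℤ | 0 ≤ m ∧ Q i j * Q j i = Q i i ^ (-m)} (-c) →
      Y.IsPrimitive (Y.dynkinElement (1 - c).toNat (v i) (v j))) ∧
    (∀ (C : Matrix (Fin n) (Fin n) ℤ) (d : Fin n → ℕ) (q : ℂ),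
      (∀ i, C i i = 2) → (∀ i j, i ≠ j → C i j ≤ 0) →
      (∀ i, 0 < d i) → (∀ i j, d i * C i j = d j * C j i) →
      q ≠ 0 → (∀ m : ℕ, 1 ≤ m → q ^ m ≠ 1) →
      (∀ i j, Q i j = q ^ (d i * C i j)) →
      ∀ i j, i ≠ j →
        Y.dynkinElement (1 - C i j).toNat (v i) (v j) =
          serreElement (q ^ d i) (1 - C i j).toNat
            (TensorAlgebra.ι ℂ (v i)) (TensorAlgebra.ι ℂ (v j)) ∧
        Y.IsPrimitive (serreElement (q ^ d i) (1 - C i j).toNat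
          (TensorAlgebra.ι ℂ (v i)) (TensorAlgebra.ι ℂ (v j)))) := by
  -- Both parts rest on this: `q_ii^{-c} q_ij q_ji = 1` is the vanishing condition for `y_{d+1}`
  -- with `d = -c`.
  have hprim : ∀ (i j : Fin n) (c : ℤ), c ≤ 0 → Q i j * Q j i = Q i i ^ c →
      Y.IsPrimitive (Y.dynkinElement (1 - c).toNat (v i) (v j)) := by
    intro i j c hc h
    rw [hY.dynkinElement_eq hQ, show (1 - c).toNat = (-c).toNat + 1 by omega]
    refine hY.isPrimitive_iteratedBracket hQ i j ?_
    have h0 : Q i i ≠ 0 := by rw [hQ]; exact Units.ne_zero _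
    rw [h, ← zpow_natCast, ← zpow_add₀ h0, show (((-c).toNat : ℕ) : ℤ) + c = 0 by omega, zpow_zero]
  refine ⟨fun i j c _ hc => hprim i j c (by have := hc.1.1; omega) (by simpa using hc.1.2), ?_⟩
  intro C d q hC2 hC hd hsym hq0 hq hQq i j hij
  have hp0 : q ^ d i ≠ 0 := pow_ne_zero _ hq0
  have hp : ∀ m : ℕ, 1 ≤ m → (q ^ d i) ^ m ≠ 1 := fun m hm => by
    rw [← pow_mul]
    exact hq _ (Nat.mul_pos (hd i) hm)
  have hii : Q i i = (q ^ d i) ^ 2 := by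
    rw [hQq, hC2, ← pow_mul, ← zpow_natCast]
    push_cast
    rfl
  have hijp : Q i j = (q ^ d i) ^ C i j := by rw [hQq, zpow_mul, zpow_natCast]
  -- The symmetry `d_i c_ij = d_j c_ji` makes `q_ji` equal to `q_ij`, so their product is `p^{2c} =
  -- q_ii^c`.
  have hji : Q j i = (q ^ d i) ^ C i j := by rw [hQq, ← hsym, zpow_mul, zpow_natCast]
  have heq : Y.dynkinElement (1 - C i j).toNat (v i) (v j) =
      serreElement (q ^ d i) (1 - C i j).toNat
        (TensorAlgebra.ι ℂ (v i)) (TensorAlgebra.ι ℂ (v j)) := by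
    rw [hY.dynkinElement_eq hQ, hii, hijp, iteratedBracket_eq_serreElement hp0 hp (hC i j hij)]
  refine ⟨heq, heq ▸ hprim i j (C i j) (hC i j hij) ?_⟩
  rw [hijp, hji, hii, ← zpow_natCast (q ^ d i) 2, ← zpow_mul, ← zpow_add₀ hp0]
  congr 1
  push_cast
  ring
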